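/- Let $G=(V,E)$ be a finite simple graph and $D\subseteq V$ a set of guards. In each turn of the eternal domination game on $(G,D)$, Attacker attacks a vertex $v$ that carries no guard, and Defender must move a guard from a neighbour $u$ of $v$ to $v$, so that the set of guards $S$ becomes $(S\setminus\{u\})\cup\{v\}$; Defender loses if no neighbour of $v$ carries a guard. A strategy for Attacker is a function mapping each set $S$ of $|D|$ vertices to a vertex of $V\setminus S$, and a strategy for Defender is a partial function mapping each pair $(S,v)$ with $|S|=|D|$ and $v\in V\setminus S$ to a vertex of $N(v)\cap S$ whenever this set is nonempty. Let $t_G(D)\in\{1,2,\dots\}\cup\{+\infty\}$ be the minimum $t$ such that Attacker has a strategy against which no strategy of Defender resists $t$ attacks starting from $D$, and $t_G(D)=+\infty$ if no such $t$ exists. Fast-Strategy is the following decision problem: given a finite simple graph $G=(V,E)$, a set $D\subseteq V$ and an integer $t\ge 1$, decide whether $t_G(D)\le t$. **Theorem.** Fast-Strategy can be solved in polynomial time on trees. That is, there are a deterministic algorithm (a program of a random access machine whose arithmetic instructions are addition and subtraction, each instruction costing one step) and a polynomial $p$ such that, for every input $(G,D,t)$ in which $G$ is a tree, the algorithm decides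 correctly whether $t_G(D)\le t$ in at most $p(\ell)$ steps, where $\ell$ is the length of the binary encoding of $(G,D,t)$ (adjacency matrix of $G$, indicator vector of $D$, binary digits of $t$). -/

import Mathlib

/-! ## Random access machines with a step count -/

namespace RAM

/-- Programs of a deterministic random access machine, in structured form. The memory consists of
registers `0, 1, 2, …`, each holding a natural number; the input is a read-only bit string. -/
inductive Prog : Type where
  /-- do nothing -/
  | skip : Prog
  /-- `M[i] := c` -/
  | const (i c : ℕ) : Prog
  /-- `M[i] := M[j] + M[k]` -/
  | add (i j k : ℕ) : Prog
  /-- `M[i] := max (M[j] - M[k]) 0` -/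
  | sub (i j k : ℕ) : Prog
  /-- indirect read, `M[i] := M[M[j]]` -/
  | load (i j : ℕ) : Prog
  /-- indirect write, `M[M[i]] := M[j]` -/
  | store (i j : ℕ) : Prog
  /-- `M[i] := ` code of the input symbol at position `M[j]` -/
  | read (i j : ℕ) : Prog
  /-- sequential composition -/
  | seq (a b : Prog) : Prog
  /-- if `M[i] ≠ 0` then `a` else `b` -/
  | ite (i : ℕ) (a b : Prog) : Prog
  /-- while `M[i] ≠ 0` do `a` -/
  | loop (i : ℕ) (a : Prog) : Prog

/-- The contents of the memory. -/
abbrev Memory : Type := ℕ → ℕ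

/-- The code of the symbol at position `p` (counted from `0`) of the input `w`:
`1` for the bit `false`, `2` for the bit `true`, and `0` beyond the end of the input. -/
def symbol (w : List Bool) (p : ℕ) : ℕ :=
  match w[p]? with
  | none => 0
  | some false => 1
  | some true => 2

/-- `Exec w c M k M'`: on input `w`, the program `c` started with memory `M` halts after exactly
`k` steps with memory `M'`. Every elementary instruction and every test costs one step. -/
inductive Exec (w : List Bool) : Prog → Memory → ℕ → Memory → Prop where
  | skip (M : Memory) : Exec w .skip M 1 M
  | const (i c : ℕ) (M : Memory) : Exec w (.const i c) M 1 (Function.update M i c)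
  | add (i j k : ℕ) (M : Memory) : Exec w (.add i j k) M 1 (Function.update M i (M j + M k))
  | sub (i j k : ℕ) (M : Memory) : Exec w (.sub i j k) M 1 (Function.update M i (M j - M k))
  | load (i j : ℕ) (M : Memory) : Exec w (.load i j) M 1 (Function.update M i (M (M j)))
  | store (i j : ℕ) (M : Memory) : Exec w (.store i j) M 1 (Function.update M (M i) (M j))
  | read (i j : ℕ) (M : Memory) :
      Exec w (.read i j) M 1 (Function.update M i (symbol w (M j)))
  | seq {a b : Prog} {M M₁ M₂ : Memory} {k₁ k₂ : ℕ} :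
      Exec w a M k₁ M₁ → Exec w b M₁ k₂ M₂ → Exec w (.seq a b) M (k₁ + k₂) M₂
  | ite_true {i : ℕ} {a b : Prog} {M M₁ : Memory} {k : ℕ} :
      M i ≠ 0 → Exec w a M k M₁ → Exec w (.ite i a b) M (k + 1) M₁
  | ite_false {i : ℕ} {a b : Prog} {M M₁ : Memory} {k : ℕ} :
      M i = 0 → Exec w b M k M₁ → Exec w (.ite i a b) M (k + 1) M₁
  | loop_stop {i : ℕ} {a : Prog} {M : Memory} :
      M i = 0 → Exec w (.loop i a) M 1 M
  | loop_step {i : ℕ} {a : Prog} {M M₁ M₂ : Memory} {k₁ k₂ : ℕ} :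
      M i ≠ 0 → Exec w a M k₁ M₁ → Exec w (.loop i a) M₁ k₂ M₂ →
      Exec w (.loop i a) M (k₁ + k₂ + 1) M₂

/-- Execution is deterministic: the running time and the final memory are unique. -/
theorem Exec.det {w : List Bool} {c : Prog} {M M₁ M₂ : Memory} {k₁ k₂ : ℕ}
    (h₁ : Exec w c M k₁ M₁) (h₂ : Exec w c M k₂ M₂) : k₁ = k₂ ∧ M₁ = M₂ := by
  induction h₁ generalizing k₂ M₂ with
  | seq _ _ iha ihb =>
    cases h₂ with
    | seq ha hb =>
      obtain ⟨rfl, rfl⟩ := iha ha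
      obtain ⟨rfl, rfl⟩ := ihb hb
      exact ⟨rfl, rfl⟩
  | ite_true hi _ ih =>
    cases h₂ with
    | ite_true _ h => obtain ⟨rfl, rfl⟩ := ih h; exact ⟨rfl, rfl⟩
    | ite_false h0 _ => exact absurd h0 hi
  | ite_false hi _ ih =>
    cases h₂ with
    | ite_true h0 _ => exact absurd hi h0
    | ite_false _ h => obtain ⟨rfl, rfl⟩ := ih h; exact ⟨rfl, rfl⟩
  | loop_stop hi =>
    cases h₂ with
    | loop_stop _ => exact ⟨rfl, rfl⟩
    | loop_step h0 _ _ => exact absurd hi h0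
  | loop_step hi _ _ iha ihb =>
    cases h₂ with
    | loop_stop h0 => exact absurd h0 hi
    | loop_step _ ha hb =>
      obtain ⟨rfl, rfl⟩ := iha ha
      obtain ⟨rfl, rfl⟩ := ihb hb
      exact ⟨rfl, rfl⟩
  | _ => cases h₂; exact ⟨rfl, rfl⟩

open Classical in
/-- The decision problem `P` on instances of type `α`, encoded as bit strings by `enc`, is solvable
in polynomial time: one program, started on the encoding of any instance with all registers equal
to `0`, halts within a number of steps that is polynomial in the length of the encoding, with
`1` in register `0` if the answer is yes, and with `0` in register `0` if the answer is no. -/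
def PolyTimeDecidable {α : Type} (enc : α → List Bool) (P : α → Prop) : Prop :=
  ∃ (c : Prog) (p : Polynomial ℕ), ∀ a : α, ∃ (k : ℕ) (M : Memory),
    Exec (enc a) c (fun _ => 0) k M ∧ k ≤ p.eval (enc a).length ∧ M 0 = if P a then 1 else 0

end RAM

/-! ## The eternal domination game -/

namespace EternalDomination

variable {V : Type*} [DecidableEq V]

/-- `f` is a strategy for Attacker with `g` guards: it maps each set `S` of `g` vertices
to a vertex outside `S`. (The values of `f` at sets of other sizes are irrelevant.) -/
def IsAttackerStrategy (g : ℕ) (f : Finset V → V) : Prop :=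
  ∀ S : Finset V, S.card = g → f S ∉ S

/-- `d` is a strategy for Defender with `g` guards: it maps each pair of a set `S` of `g` vertices
and an attacked vertex `v` outside `S` to a neighbour of `v` in `S` if there is one, and is
undefined (has value `none`) otherwise. -/
def IsDefenderStrategy (G : SimpleGraph V) (g : ℕ) (d : Finset V → V → Option V) : Prop :=
  ∀ (S : Finset V) (v : V), S.card = g → v ∉ S →
    (∀ u, d S v = some u → u ∈ S ∧ G.Adj v u) ∧
    (d S v = none → ∀ u ∈ S, ¬ G.Adj v u)

/-- Defender resists `t` attacks from the guard set `S` when the strategies `f` and `d` are used: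
the guard on `u = d S (f S)` moves to the attacked vertex `f S`. -/
def Resists (f : Finset V → V) (d : Finset V → V → Option V) : ℕ → Finset V → Prop
  | 0, _ => True
  | t + 1, S => ∃ u, d S (f S) = some u ∧ Resists f d t (insert (f S) (S.erase u))

/-- Attacker wins within `t` turns on `(G, D)`: he has a strategy against which no strategy of
Defender resists `t` attacks. -/
def AttackerWins (G : SimpleGraph V) (D : Finset V) (t : ℕ) : Prop :=
  ∃ f : Finset V → V, IsAttackerStrategy D.card f ∧
    ∀ d : Finset V → V → Option V, IsDefenderStrategy G D.card d → ¬ Resists f d t D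

/-- `t_G(D)`, the least `t` such that Attacker wins within `t` turns on `(G, D)`; it is `⊤` if
there is none. -/
noncomputable def attackTime (G : SimpleGraph V) (D : Finset V) : ℕ∞ :=
  ⨅ (t : ℕ) (_ : AttackerWins G D t), (t : ℕ∞)

/-- An instance of the problem Fast-Strategy: a finite graph with vertices `0, …, n - 1`, a set of
guards and an integer `t ≥ 1`. -/
structure Instance : Type where
  n : ℕ
  G : SimpleGraph (Fin n)
  D : Finset (Fin n)
  t : ℕ
  one_le_t : 1 ≤ t

open Classical in
/-- The encoding of an instance: `n` in unary followed by a separator, the adjacency matrix row by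
row (`k = i * n + j` has `k.divNat = i` and `k.modNat = j`), the indicator vector of the set of
guards, and the binary digits of `t`, least significant digit first. -/
noncomputable def Instance.encode (I : Instance) : List Bool :=
  List.replicate I.n true ++ [false]
    ++ List.ofFn (fun k : Fin (I.n * I.n) => decide (I.G.Adj k.divNat k.modNat))
    ++ List.ofFn (fun i : Fin I.n => decide (i ∈ I.D))
    ++ I.t.bits

/-- The question asked by Fast-Strategy. -/
def Instance.FastStrategy (I : Instance) : Prop :=
  attackTime I.G I.D ≤ (I.t : ℕ∞)

end EternalDomination

/-!
Why Fast-Strategy is easy on trees.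

*The game.* Since the value of the game is reached by positional strategies, Attacker wins within
`t` turns in the sense of the problem if and only if he can force a win when the moves are made one
after the other (`attackTime_le_iff`, about the recursive predicate `Wins`).

*Structure of fast wins.* Suppose that Attacker attacks `v`. The guard that answers comes from a
neighbour `u` of `v`, and leaves `u` unguarded, so that Attacker may go on in the part of the tree
beyond `u`. For Attacker to succeed he must have a continuation for each guard next to `v`.
Unfolding this, he needs a set of unguarded vertices forming a tree whose edges are guards: every
guard next to a vertex of the set is next to exactly two of them. An attack on a vertex of this tree removes
the vertex and leaves Attacker with one of the components, of Defender's choice; so the number of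
turns is the least number of labels in a ranking of the tree, a labelling in which any two
vertices with equal labels are separated by a vertex with a greater label. The predicate `Branch`
describes rooted trees of this kind together with the binary mask of the labels visible from the
root, and `wins_iff` is the resulting characterization. One direction attacks the vertex with the
greatest label (`Branch.attack`); the other one takes the trees that exist after each possible
answer of Defender back to the situation before it (`Branch.before_move`), which requires moving the
root (`Branch.reroot`).

*Least masks.* Masks are compared as numbers. The least mask of a branch is determined by the least
masks of its children: it is `merge + 1`, where `merge` has the digits of the masks of the children
and all digits up to the greatest one that is shared by two of them (`combine_merge`,
`merge_lt_of_combine`). Hence a table of least masks, one for each branch, can be filled in by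
recomputing all entries as many times as there are vertices (`progress_rounds`), and
`wins_iff_table` reads off the answer.

*Machines.* Expressions with bounded iteration and commands that store their values in a heap are
compiled to programs (`exists_prog`); as all iterations are bounded by the length of the input, the
running time is polynomial. It remains to write the algorithm in this language.
-/


namespace EternalDomination

/-! ### The value of the game -/

section Game

variable {V : Type*} [DecidableEq V]

/-- Attacker can force a win within `t` turns from the guard set `D`, the players choosing their
moves one after the other. -/
def Wins (G : SimpleGraph V) : ℕ → Finset V → Prop
  | 0, _ => False
  | t + 1, D => ∃ v ∉ D, ∀ u ∈ D, G.Adj v u → Wins G t (insert v (D.erase u))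

theorem Wins.succ {G : SimpleGraph V} {t : ℕ} {D : Finset V} (h : Wins G t D) :
    Wins G (t + 1) D := by
  induction t generalizing D with
  | zero => exact h.elim
  | succ t ih =>
    obtain ⟨v, hv, h⟩ := h
    exact ⟨v, hv, fun u hu hvu => ih (h u hu hvu)⟩

theorem Wins.mono {G : SimpleGraph V} {s t : ℕ} {D : Finset V} (h : Wins G s D) (hst : s ≤ t) :
    Wins G t D := by
  induction hst with
  | refl => exact h
  | step _ ih => exact ih.succ

theorem card_insert_erase {D : Finset V} {u v : V} (hu : u ∈ D) (hv : v ∉ D) :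
    (insert v (D.erase u)).card = D.card := by
  rw [Finset.card_insert_of_notMem (fun h => hv (Finset.mem_of_mem_erase h)),
    Finset.card_erase_of_mem hu]
  have := Finset.card_pos.2 ⟨u, hu⟩
  omega

/-- Attacking, at every guard set, a vertex that is optimal for the least number of turns in which
the win can still be forced is a positional strategy, and it is as fast as any other. -/
theorem Wins.attackerWins [Fintype V] {G : SimpleGraph V} {t : ℕ} {D : Finset V}
    (h : Wins G t D) : AttackerWins G D t := by
  classical
  have hcard : D.card < Fintype.card V := by
    cases t with
    | zero => exact h.elim
    | succ t =>
      obtain ⟨v, hv, -⟩ := h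
      exact Finset.card_lt_univ_of_notMem hv
  have key : ∀ S : Finset V, S.card = D.card → ∃ v ∉ S, ∀ s, Wins G s S →
      ∀ u ∈ S, G.Adj v u → Wins G (s - 1) (insert v (S.erase u)) := by
    intro S hS
    by_cases hw : ∃ s, Wins G s S
    · obtain ⟨r, hr⟩ : ∃ r, Nat.find hw = r := ⟨_, rfl⟩
      have hspec := Nat.find_spec hw
      rw [hr] at hspec
      cases r with
      | zero => exact hspec.elim
      | succ r =>
        obtain ⟨v, hv, hwin⟩ := hspec
        refine ⟨v, hv, fun s hs u hu hvu => (hwin u hu hvu).mono ?_⟩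
        have := Nat.find_min' hw hs
        omega
    · obtain ⟨v, hv⟩ : ∃ v, v ∉ S := by
        by_contra hc
        push Not at hc
        rw [Finset.eq_univ_of_forall hc, Finset.card_univ] at hS
        omega
      exact ⟨v, hv, fun s hs => (hw ⟨s, hs⟩).elim⟩
  have hne : Nonempty V := by
    rw [← Fintype.card_pos_iff]
    omega
  let f : Finset V → V := fun S =>
    if hS : S.card = D.card then (key S hS).choose else hne.some
  have hf : ∀ S (hS : S.card = D.card), f S ∉ S ∧ ∀ s, Wins G s S →
      ∀ u ∈ S, G.Adj (f S) u → Wins G (s - 1) (insert (f S) (S.erase u)) := by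
    intro S hS
    simp only [f, dif_pos hS]
    exact (key S hS).choose_spec
  refine ⟨f, fun S hS => (hf S hS).1, fun d hd => ?_⟩
  have main : ∀ s S, S.card = D.card → Wins G s S → ¬ Resists f d s S := by
    intro s
    induction s with
    | zero => exact fun S _ h => h.elim
    | succ s ih =>
      rintro S hS hw ⟨u, hu, hres⟩
      obtain ⟨hnot, hwin⟩ := hf S hS
      obtain ⟨huS, hadj⟩ := (hd S (f S) hS hnot).1 u hu
      exact ih _ ((card_insert_erase huS hnot).trans hS) (hwin _ hw u huS hadj) hres
  exact main t D rfl h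

/-- Answering every attack by the move after which Attacker needs the most turns is a positional
strategy for Defender, which resists `t` attacks whenever this is possible. -/
theorem AttackerWins.wins {G : SimpleGraph V} {t : ℕ} {D : Finset V}
    (h : AttackerWins G D t) : Wins G t D := by
  classical
  obtain ⟨f, hf, h⟩ := h
  have key : ∀ (S : Finset V) (v : V), (∃ u ∈ S, G.Adj v u) → ∃ u ∈ S, G.Adj v u ∧
      ∀ s, Wins G s (insert v (S.erase u)) →
        ∀ u' ∈ S, G.Adj v u' → Wins G s (insert v (S.erase u')) := by
    rintro S v ⟨u₀, hu₀, hvu₀⟩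
    let rank : V → ℕ∞ := fun u => ⨅ (s : ℕ) (_ : Wins G s (insert v (S.erase u))), (s : ℕ∞)
    obtain ⟨u, hu, hmax⟩ := Finset.exists_max_image (S.filter fun u => G.Adj v u) rank
      ⟨u₀, by simp [hu₀, hvu₀]⟩
    rw [Finset.mem_filter] at hu
    refine ⟨u, hu.1, hu.2, fun s hs u' hu' hvu' => ?_⟩
    have h1 : rank u' ≤ s :=
      (hmax u' (by simp [hu', hvu'])).trans (iInf₂_le (f := fun (s : ℕ) _ => (s : ℕ∞)) s hs)
    by_contra hc
    have h2 : ((s + 1 : ℕ) : ℕ∞) ≤ rank u' := by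
      refine le_iInf₂ fun r hr => ?_
      by_contra hlt
      refine hc (Wins.mono hr ?_)
      have : r < s + 1 := by exact_mod_cast not_le.1 hlt
      omega
    have := h2.trans h1
    norm_cast at this
    omega
  let d : Finset V → V → Option V := fun S v =>
    if hS : ∃ u ∈ S, G.Adj v u then some (key S v hS).choose else none
  have hd : IsDefenderStrategy G D.card d := by
    intro S v _ _
    by_cases hS : ∃ u ∈ S, G.Adj v u
    · have hspec := (key S v hS).choose_spec
      simp only [d, dif_pos hS]
      refine ⟨fun u hu => ?_, fun hn => by simp at hn⟩
      rw [← Option.some.inj hu]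
      exact ⟨hspec.1, hspec.2.1⟩
    · simp only [d, dif_neg hS]
      refine ⟨fun u hu => by simp at hu, fun _ u hu hvu => hS ⟨u, hu, hvu⟩⟩
  by_contra hw
  have main : ∀ s S, S.card = D.card → ¬ Wins G s S → Resists f d s S := by
    intro s
    induction s with
    | zero => exact fun _ _ _ => trivial
    | succ s ih =>
      intro S hS hns
      have hfS := hf S hS
      have hex : ∃ u ∈ S, G.Adj (f S) u ∧ ¬ Wins G s (insert (f S) (S.erase u)) := by
        by_contra hc
        push Not at hc
        exact hns ⟨f S, hfS, hc⟩
      obtain ⟨u', hu', hadj', hnw⟩ := hex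
      have hS' : ∃ u ∈ S, G.Adj (f S) u := ⟨u', hu', hadj'⟩
      have hspec := (key S (f S) hS').choose_spec
      refine ⟨(key S (f S) hS').choose, by simp only [d, dif_pos hS'], ih _ ?_ ?_⟩
      · rw [card_insert_erase hspec.1 hfS, hS]
      · exact fun hc => hnw (hspec.2.2 s hc u' hu' hadj')
  exact h d hd (main t D rfl hw)

theorem attackTime_le_iff [Fintype V] {G : SimpleGraph V} {t : ℕ} {D : Finset V} :
    attackTime G D ≤ t ↔ Wins G t D := by
  constructor
  · intro h
    by_contra hc
    have h2 : ((t + 1 : ℕ) : ℕ∞) ≤ attackTime G D := by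
      refine le_iInf₂ fun r hr => ?_
      by_contra hlt
      refine hc (hr.wins.mono ?_)
      have : r < t + 1 := by exact_mod_cast not_le.1 hlt
      omega
    have := h2.trans h
    norm_cast at this
    omega
  · exact fun h => iInf₂_le (f := fun (s : ℕ) (_ : AttackerWins G D s) => (s : ℕ∞)) t
      h.attackerWins

end Game

/-! ### Binary masks -/

section Mask

open Classical in
/-- The number with the binary digits `{b < N | P b}`. -/
noncomputable def mask (N : ℕ) (P : ℕ → Prop) : ℕ :=
  ∑ b ∈ Finset.range N, if P b then 2 ^ b else 0

theorem mask_lt (N : ℕ) (P : ℕ → Prop) : mask N P < 2 ^ N := by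
  induction N with
  | zero => simp [mask]
  | succ N ih =>
    simp only [mask, Finset.sum_range_succ, pow_succ] at ih ⊢
    split_ifs <;> omega

theorem testBit_mask (N : ℕ) (P : ℕ → Prop) (i : ℕ) :
    (mask N P).testBit i = true ↔ i < N ∧ P i := by
  induction N with
  | zero => simp [mask]
  | succ N ih =>
    have hs : mask (N + 1) P = mask N P + (by classical exact if P N then 2 ^ N else 0) := by
      simp only [mask, Finset.sum_range_succ]
    have hlt := mask_lt N P
    by_cases hN : P N
    · rw [hs, if_pos hN, Nat.add_comm]
      rcases lt_trichotomy i N with h | rfl | h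
      · rw [Nat.testBit_two_pow_add_gt h, ih]
        simp [h, h.trans (Nat.lt_succ_self N)]
      · rw [Nat.testBit_two_pow_add_eq, Nat.testBit_lt_two_pow hlt]
        simp [hN]
      · have h1 : 2 ^ N + mask N P < 2 ^ i :=
          lt_of_lt_of_le (by rw [pow_succ]; omega) (Nat.pow_le_pow_right (n := 2) (by norm_num) h)
        rw [Nat.testBit_lt_two_pow h1]
        simp
        omega
    · rw [hs, if_neg hN, Nat.add_zero, ih]
      constructor
      · exact fun h => ⟨by omega, h.2⟩
      · rintro ⟨h1, h2⟩
        refine ⟨lt_of_le_of_ne (by omega) ?_, h2⟩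
        rintro rfl
        exact hN h2

theorem lt_two_pow_iff_testBit {x t : ℕ} : x < 2 ^ t ↔ ∀ b, x.testBit b = true → b < t := by
  constructor
  · intro h b hb
    by_contra hc
    have h1 := Nat.ge_two_pow_of_testBit hb
    have h2 := Nat.pow_le_pow_right (n := 2) (by norm_num) (not_lt.1 hc)
    omega
  · intro h
    refine Nat.lt_pow_two_of_testBit x fun i hi => ?_
    by_contra hc
    have := h i (by simpa using hc)
    omega

end Mask

/-! ### Distances in trees -/

section Tree

variable {V : Type*} {G : SimpleGraph V}

theorem dist_adj_cases (hG : G.IsTree) {u v : V} (h : G.Adj v u) (z : V) :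
    G.dist v z = G.dist u z + 1 ∨ G.dist u z = G.dist v z + 1 := by
  rw [G.dist_comm (u := v), G.dist_comm (u := u)]
  exact hG.dist_eq_dist_add_one_of_adj z h

theorem not_adj_of_adj_adj (hG : G.IsTree) {u v w : V} (h : G.Adj v u) (h' : G.Adj u w) :
    ¬ G.Adj v w := fun hvw => by
  have h1 := SimpleGraph.dist_eq_one_iff_adj.2 h'
  have h2 := SimpleGraph.dist_eq_one_iff_adj.2 hvw
  have h3 := dist_adj_cases hG h w
  omega

/-- A vertex of a tree has at most one neighbour that is closer to a given vertex. -/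
theorem closer_unique (hG : G.IsTree) {u u' v z : V} (h : G.Adj v u) (h' : G.Adj v u')
    (hz : G.dist v z = G.dist u z + 1) (hz' : G.dist v z = G.dist u' z + 1) : u = u' := by
  obtain ⟨p, hp⟩ := hG.connected.exists_walk_length_eq_dist u z
  obtain ⟨p', hp'⟩ := hG.connected.exists_walk_length_eq_dist u' z
  have hq : (SimpleGraph.Walk.cons h p).IsPath :=
    SimpleGraph.Walk.isPath_of_length_eq_dist _ (by simp [hp, hz])
  have hq' : (SimpleGraph.Walk.cons h' p').IsPath :=
    SimpleGraph.Walk.isPath_of_length_eq_dist _ (by simp [hp', hz'])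
  have := congrArg Subtype.val
    ((hG.isAcyclic.subsingleton_path v z).elim ⟨_, hq⟩ ⟨_, hq'⟩)
  exact (SimpleGraph.Walk.cons.inj this).1

theorem exists_closer (hG : G.IsTree) {v z : V} (h : v ≠ z) :
    ∃ u, G.Adj v u ∧ G.dist v z = G.dist u z + 1 := by
  obtain ⟨p, hp⟩ := hG.connected.exists_walk_length_eq_dist v z
  cases p with
  | nil => exact (h rfl).elim
  | @cons _ u _ huv q =>
    refine ⟨u, huv, ?_⟩
    have h1 := SimpleGraph.dist_le q
    have h2 := dist_adj_cases hG huv z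
    rw [SimpleGraph.Walk.length_cons] at hp
    omega

/-- The vertices of the branch at `v` seen from its neighbour `p`: those that are separated from
`p` by `v`. For `p = v` the branch is the whole tree, rooted at `v`. -/
def InBranch (G : SimpleGraph V) (p v z : V) : Prop :=
  p = v ∨ G.dist p z = G.dist v z + 1

theorem inBranch_self {p v : V} (hp : G.Adj p v ∨ p = v) : InBranch G p v v := by
  rcases hp with hp | hp
  · right
    rw [SimpleGraph.dist_self, SimpleGraph.dist_eq_one_iff_adj.2 hp]
  · exact Or.inl hp

/-- The branches of the neighbours are contained in the branch of a vertex. -/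
theorem InBranch.of_adj (hG : G.IsTree) {p v u z : V} (hp : G.Adj p v ∨ p = v)
    (hu : G.Adj v u) (hup : u ≠ p) (hz : InBranch G v u z) : InBranch G p v z := by
  rcases hp with hp | hp
  · right
    rcases hz with hz | hz
    · exact (hu.ne hz).elim
    · rcases dist_adj_cases hG hp z with h | h
      · exact h
      · exact (hup (closer_unique hG hu hp.symm hz h)).elim
  · exact Or.inl hp

theorem inBranch_of_adj_adj (hG : G.IsTree) {p v u w z : V} (hp : G.Adj p v ∨ p = v)
    (hu : G.Adj v u) (hup : u ≠ p) (hw : G.Adj u w) (hwv : w ≠ v) (hz : InBranch G u w z) :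
    InBranch G p v z :=
  InBranch.of_adj hG hp hu hup (InBranch.of_adj hG (Or.inl hu) hw hwv hz)

theorem inBranch_neighbor (hG : G.IsTree) {p v u : V} (hp : G.Adj p v ∨ p = v)
    (hu : G.Adj v u) (hup : u ≠ p) : InBranch G p v u :=
  InBranch.of_adj hG hp hu hup (inBranch_self (Or.inl hu))

/-- A neighbour of a vertex of a branch lies in the branch, or it is the vertex from which the
branch is seen. -/
theorem InBranch.adj (hG : G.IsTree) {p v a u : V} (hp : G.Adj p v) (ha : InBranch G p v a)
    (hu : G.Adj a u) : InBranch G p v u ∨ u = p ∧ a = v := by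
  rcases ha with ha | ha
  · exact (hp.ne ha).elim
  by_cases hav : a = v
  · subst hav
    by_cases hup : u = p
    · exact Or.inr ⟨hup, rfl⟩
    · exact Or.inl (inBranch_neighbor hG (Or.inl hp) hu hup)
  · left
    right
    rcases dist_adj_cases hG hp u with h | h
    · exact h
    -- Otherwise `u` and the neighbour `u'` of `a` towards `v` are both closer to `p` than `a`,
    -- hence equal, although `u` is farther from `v` than `a`.
    · exfalso
      have h1 := dist_adj_cases hG hu v
      have h2 := dist_adj_cases hG hu p
      rw [G.dist_comm (u := p)] at ha h
      rw [G.dist_comm (u := v)] at ha h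
      obtain ⟨u', hau', hu'⟩ := exists_closer hG (z := v) hav
      have h4 := dist_adj_cases hG hau' p
      have h5 : G.dist u' p ≤ G.dist u' v + 1 := by
        have := dist_adj_cases hG hp u'
        rw [G.dist_comm (u := p), G.dist_comm (u := v)] at this
        omega
      have h6 : G.dist a p = G.dist u' p + 1 := by omega
      by_cases huu : u = u'
      · subst huu
        omega
      · have h7 : G.dist u p = G.dist a p + 1 := by
          rcases h2 with h2 | h2
          · exact (huu (closer_unique hG hu hau' h2 h6)).elim
          · exact h2
        omega

theorem not_inBranch_left {u w : V} (h : G.Adj u w) : ¬ InBranch G u w u := by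
  rintro (h1 | h1)
  · exact h.ne h1
  · rw [SimpleGraph.dist_self] at h1
    omega

/-- Branches seen from the same vertex are disjoint. -/
theorem InBranch.eq_of_adj (hG : G.IsTree) {p v v' z : V} (hv : G.Adj p v) (hv' : G.Adj p v')
    (h : InBranch G p v z) (h' : InBranch G p v' z) : v = v' := by
  rcases h with h | h
  · exact (hv.ne h).elim
  rcases h' with h' | h'
  · exact (hv'.ne h').elim
  exact closer_unique hG hv hv' h h'

/-- Two branches below the same vertex `v` are disjoint if they are reached by different
neighbours of `v`. -/
theorem not_inBranch_of_ne (hG : G.IsTree) {v u u' w w' z : V} (hu : G.Adj v u)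
    (hu' : G.Adj v u') (huu : u ≠ u') (hw : G.Adj u w) (hwv : w ≠ v) (hw' : G.Adj u' w')
    (hwv' : w' ≠ v) (h : InBranch G u w z) : ¬ InBranch G u' w' z := fun h' =>
  huu (InBranch.eq_of_adj hG hu hu' (InBranch.of_adj hG (Or.inl hu) hw hwv h)
    (InBranch.of_adj hG (Or.inl hu') hw' hwv' h'))

/-- A neighbour of `v` does not lie in a branch two steps below `v`. -/
theorem not_inBranch_neighbor (hG : G.IsTree) {v u u' w : V} (hu : G.Adj v u)
    (hu' : G.Adj v u') (hw : G.Adj u w) (hwv : w ≠ v) : ¬ InBranch G u w u' := by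
  intro h
  by_cases huu : u = u'
  · subst huu
    exact not_inBranch_left hw h
  · exact huu (InBranch.eq_of_adj hG hu hu' (InBranch.of_adj hG (Or.inl hu) hw hwv h)
      (inBranch_self (Or.inl hu')))

theorem not_inBranch_root (hG : G.IsTree) {v u w : V} (hu : G.Adj v u) (hw : G.Adj u w)
    (hwv : w ≠ v) : ¬ InBranch G u w v := fun h =>
  not_inBranch_left hu (InBranch.of_adj hG (Or.inl hu) hw hwv h)

end Tree

/-! ### Ranked trees of attacked vertices -/

section Branch

variable {V : Type*}

/-- The local condition on a ranking: at a vertex with label `c` whose children, indexed by `S`,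
have the masks `y` of labels visible from them, the label `c` is not visible from any child, and no
label greater than `c` is visible from two children; `x` is the mask of the labels visible from the
vertex itself, namely `c` and the labels greater than `c` of the children. -/
structure Combine {ι : Type*} (S : ι → Prop) (y : ι → ℕ) (c x : ℕ) : Prop where
  not_mem : ∀ u, S u → (y u).testBit c = false
  disj : ∀ u u', S u → S u' → u ≠ u' → ∀ b, c < b →
    (y u).testBit b = true → (y u').testBit b = true → False
  testBit_iff : ∀ b, x.testBit b = true ↔ b = c ∨ c < b ∧ ∃ u, S u ∧ (y u).testBit b = true

/-- `u` is a guard next to `v`, other than `p`. -/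
def Child (G : SimpleGraph V) (D : Finset V) (p v u : V) : Prop :=
  u ∈ D ∧ G.Adj v u ∧ u ≠ p

/-- `Branch G D p v x`: in the branch at `v` seen from `p` there is a tree of unguarded vertices
rooted at `v`, whose edges are guards: every guard next to a vertex of the tree other than the one
leading to its parent leads to exactly one child. The tree has a ranking, a labelling by natural
numbers in which any two vertices with equal labels are separated by one with a greater label, such
that `x` is the binary mask of the labels visible from the root, that is, of those labels that
occur at a vertex which no greater label separates from the root.
For `p = v` all guards next to the root lead to children. -/
inductive Branch (G : SimpleGraph V) (D : Finset V) : V → V → ℕ → Prop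
  | mk (p v : V) (w : V → V) (y : V → ℕ) (c x : ℕ) (hv : v ∉ D)
      (hw : ∀ u, Child G D p v u → G.Adj u (w u) ∧ w u ≠ v)
      (hb : ∀ u, Child G D p v u → Branch G D u (w u) (y u))
      (hc : Combine (Child G D p v) y c x) : Branch G D p v x

theorem Combine.exists_mask {ι : Type*} {S S' : ι → Prop} {y y' : ι → ℕ} {c x : ℕ}
    (h : Combine S y c x) (hS : ∀ u, S' u → S u)
    (hy : ∀ u b, (y' u).testBit b = true → (y u).testBit b = true) :
    ∃ x', Combine S' y' c x' := by
  have hlt : x < 2 ^ x := Nat.lt_two_pow_self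
  refine ⟨mask x fun b => b = c ∨ c < b ∧ ∃ u, S' u ∧ (y' u).testBit b = true, ?_, ?_, ?_⟩
  · intro u hu
    by_contra hc
    have := hy u c (by simpa using hc)
    rw [h.not_mem u (hS u hu)] at this
    exact Bool.noConfusion this
  · exact fun u u' hu hu' hne b hb h1 h2 =>
      h.disj u u' (hS u hu) (hS u' hu') hne b hb (hy _ _ h1) (hy _ _ h2)
  · intro b
    rw [testBit_mask, and_iff_right_iff_imp]
    intro hb
    refine lt_two_pow_iff_testBit.1 hlt b ((h.testBit_iff b).2 ?_)
    rcases hb with hb | ⟨hb, u, hu, hub⟩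
    · exact Or.inl hb
    · exact Or.inr ⟨hb, u, hS u hu, hy u b hub⟩

theorem Combine.label_mem {ι : Type*} {S : ι → Prop} {y : ι → ℕ} {c x : ℕ}
    (h : Combine S y c x) : x.testBit c = true := (h.testBit_iff c).2 (Or.inl rfl)

/-- Only the guards in a branch matter for the trees in it. -/
theorem Branch.congr {G : SimpleGraph V} (hG : G.IsTree) {D D' : Finset V} {p v : V} {x : ℕ}
    (h : Branch G D p v x) (hp : G.Adj p v ∨ p = v)
    (hD : ∀ z, InBranch G p v z → (z ∈ D ↔ z ∈ D')) : Branch G D' p v x := by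
  induction h with
  | mk p v w y c x hv hw hb hc ih =>
    have hS : Child G D' p v = Child G D p v := by
      funext u
      simp only [Child, eq_iff_iff]
      constructor
      · exact fun ⟨h1, h2, h3⟩ => ⟨(hD u (inBranch_neighbor hG hp h2 h3)).2 h1, h2, h3⟩
      · exact fun ⟨h1, h2, h3⟩ => ⟨(hD u (inBranch_neighbor hG hp h2 h3)).1 h1, h2, h3⟩
    refine Branch.mk p v w y c x (fun h => hv ((hD v (inBranch_self hp)).2 h)) ?_ ?_ ?_
    · rw [hS]
      exact hw
    · rw [hS]
      intro u hu
      refine ih u hu (Or.inl (hw u hu).1) fun z hz => hD z ?_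
      exact inBranch_of_adj_adj hG hp hu.2.1 hu.2.2 (hw u hu).1 (hw u hu).2 hz
    · rw [hS]
      exact hc

/-- A tree stays valid, up to the loss of some visible labels, with a different parent and
different guards as long as no new guard appears next to its root and the branches of the remaining
children do not change. -/
theorem Branch.restrict {G : SimpleGraph V} (hG : G.IsTree) {D D' : Finset V} {p p' v : V}
    {x : ℕ} (h : Branch G D p v x) (hv : v ∉ D')
    (hS : ∀ u, Child G D' p' v u → Child G D p v u)
    (hD : ∀ u w z, Child G D' p' v u → G.Adj u w → w ≠ v → InBranch G u w z →
      (z ∈ D ↔ z ∈ D')) : ∃ x' ≤ x, Branch G D' p' v x' := by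
  cases h with
  | mk _ _ w y c _ _ hw hb hc =>
    obtain ⟨x', hx'⟩ := hc.exists_mask hS fun _ _ h => h
    refine ⟨x', Nat.le_of_testBit fun b hb => ?_, Branch.mk p' v w y c x' hv
      (fun u hu => hw u (hS u hu)) (fun u hu => ?_) hx'⟩
    · rw [hc.testBit_iff]
      exact ((hx'.testBit_iff b).1 hb).imp id fun ⟨h1, u, hu, h2⟩ => ⟨h1, u, hS u hu, h2⟩
    · have hwu := hw u (hS u hu)
      exact (hb u (hS u hu)).congr hG (Or.inl hwu.1) fun z hz => hD u (w u) z hu hwu.1 hwu.2 hz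

theorem Combine.child_lt {ι : Type*} {S : ι → Prop} {y : ι → ℕ} {c x t : ℕ}
    (h : Combine S y c x) (hx : x < 2 ^ t) {u : ι} (hu : S u) : y u < 2 ^ t := by
  refine lt_two_pow_iff_testBit.2 fun b hb => ?_
  have hct := lt_two_pow_iff_testBit.1 hx c h.label_mem
  rcases le_or_gt b c with hbc | hbc
  · omega
  · exact lt_two_pow_iff_testBit.1 hx b ((h.testBit_iff b).2 (Or.inr ⟨hbc, u, hu, hb⟩))

variable [DecidableEq V]

/-- A ranked tree can be re-rooted at a child of its root, with the same labels. -/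
theorem Branch.reroot {G : SimpleGraph V} {D : Finset V} {v u : V} {w : V → V} {y : V → ℕ}
    {c x t : ℕ} (hv : v ∉ D) (hw : ∀ u, Child G D v v u → G.Adj u (w u) ∧ w u ≠ v)
    (hb : ∀ u, Child G D v v u → Branch G D u (w u) (y u))
    (hc : Combine (Child G D v v) y c x) (hx : x < 2 ^ t) (hCu : Child G D v v u) :
    ∃ x' < 2 ^ t, Branch G D (w u) (w u) x' := by
  obtain ⟨hu, hvu, -⟩ := id hCu
  obtain ⟨x₁, hx₁⟩ := hc.exists_mask (S' := Child G D u v)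
    (fun u' h => ⟨h.1, h.2.1, h.2.1.ne'⟩) fun _ _ h => h
  have hup : Branch G D u v x₁ :=
    Branch.mk u v w y c x₁ hv (fun u' h => hw u' ⟨h.1, h.2.1, h.2.1.ne'⟩)
      (fun u' h => hb u' ⟨h.1, h.2.1, h.2.1.ne'⟩) hx₁
  have hct : c < t := lt_two_pow_iff_testBit.1 hx c hc.label_mem
  have hyt : ∀ u', Child G D v v u' → ∀ b, (y u').testBit b = true → b < t :=
    fun u' hu' => lt_two_pow_iff_testBit.1 (hc.child_lt hx hu')
  have hdown := hb u hCu
  have hxu : y u < 2 ^ t := lt_two_pow_iff_testBit.2 (hyt u hCu)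
  have hadj := (hw u hCu).1
  have hne := (hw u hCu).2
  obtain ⟨x₀, hx₀⟩ : ∃ x₀, x₀ = y u := ⟨_, rfl⟩
  obtain ⟨a, ha⟩ : ∃ a, a = w u := ⟨_, rfl⟩
  have hcu := hc.not_mem u hCu
  have hdu := fun u' hu' hne b => hc.disj u u' hCu hu' hne b
  rw [← hx₀, ← ha] at hdown
  rw [← hx₀] at hxu hcu hdu
  rw [← ha] at hadj hne ⊢
  cases hdown with
  | mk _ _ w' y' c' _ hv' hw' hb' hc' =>
  have hSu : ∀ u', Child G D a a u' → u' ≠ u → Child G D u a u' :=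
    fun u' h h' => ⟨h.1, h.2.1, h'⟩
  -- the label of the new root is visible from it, so it differs from the label of the old root
  have hc1 : x₁.testBit c' = false := by
    by_contra hcon
    rw [Bool.not_eq_false, hx₁.testBit_iff] at hcon
    rcases hcon with h | ⟨h, u', hu', hb''⟩
    · rw [← h, hc'.label_mem] at hcu
      exact Bool.noConfusion hcu
    · exact hdu u' ⟨hu'.1, hu'.2.1, hu'.2.1.ne'⟩ hu'.2.2.symm c' h hc'.label_mem hb''
  have hd1 : ∀ u', Child G D u a u' → ∀ b, c' < b → x₁.testBit b = true →
      (y' u').testBit b = true → False := by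
    intro u' hu' b hb1 hb2 hb3
    have hb4 : x₀.testBit b = true := (hc'.testBit_iff b).2 (Or.inr ⟨hb1, u', hu', hb3⟩)
    rcases (hx₁.testBit_iff b).1 hb2 with h | ⟨h, u'', hu'', hb5⟩
    · rw [h, hcu] at hb4
      exact Bool.noConfusion hb4
    · exact hdu u'' ⟨hu''.1, hu''.2.1, hu''.2.1.ne'⟩ hu''.2.2.symm b h hb4 hb5
  have hlt : ∀ u', Child G D a a u' → ∀ b, c' < b →
      (Function.update y' u x₁ u').testBit b = true → b < t := by
    intro u' hu' b hb1 hb2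
    by_cases huu : u' = u
    · subst huu
      rw [Function.update_self] at hb2
      rcases (hx₁.testBit_iff b).1 hb2 with h | ⟨_, u'', hu'', hb5⟩
      · omega
      · exact hyt u'' ⟨hu''.1, hu''.2.1, hu''.2.1.ne'⟩ b hb5
    · rw [Function.update_of_ne huu] at hb2
      exact lt_two_pow_iff_testBit.1 hxu b
        ((hc'.testBit_iff b).2 (Or.inr ⟨hb1, u', hSu u' hu' huu, hb2⟩))
  have hct' : c' < t := lt_two_pow_iff_testBit.1 hxu c' hc'.label_mem
  refine ⟨mask t fun b => b = c' ∨ c' < b ∧ ∃ u', Child G D a a u' ∧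
    (Function.update y' u x₁ u').testBit b = true, mask_lt _ _, ?_⟩
  refine Branch.mk a a (Function.update w' u v) (Function.update y' u x₁) c' _ hv' ?_ ?_
    ⟨?_, ?_, ?_⟩
  · intro u' hu'
    by_cases huu : u' = u
    · subst huu
      rw [Function.update_self]
      exact ⟨hvu.symm, hne.symm⟩
    · rw [Function.update_of_ne huu]
      exact hw' u' (hSu u' hu' huu)
  · intro u' hu'
    by_cases huu : u' = u
    · subst huu
      rw [Function.update_self, Function.update_self]
      exact hup
    · rw [Function.update_of_ne huu, Function.update_of_ne huu]
      exact hb' u' (hSu u' hu' huu)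
  · intro u' hu'
    by_cases huu : u' = u
    · subst huu
      rw [Function.update_self]
      exact hc1
    · rw [Function.update_of_ne huu]
      exact hc'.not_mem u' (hSu u' hu' huu)
  · intro u₁ u₂ hu₁ hu₂ hne12 b hb0 hb1 hb2
    by_cases h1 : u₁ = u
    · subst h1
      rw [Function.update_self] at hb1
      rw [Function.update_of_ne hne12.symm] at hb2
      exact hd1 u₂ (hSu u₂ hu₂ hne12.symm) b hb0 hb1 hb2
    · rw [Function.update_of_ne h1] at hb1
      by_cases h2 : u₂ = u
      · subst h2
        rw [Function.update_self] at hb2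
        exact hd1 u₁ (hSu u₁ hu₁ h1) b hb0 hb2 hb1
      · rw [Function.update_of_ne h2] at hb2
        exact hc'.disj u₁ u₂ (hSu u₁ hu₁ h1) (hSu u₂ hu₂ h2) hne12 b hb0 hb1 hb2
  · intro b
    rw [testBit_mask, and_iff_right_iff_imp]
    rintro (h | ⟨h, u', hu', hb1⟩)
    · omega
    · exact hlt u' hu' b h hb1

/-- Attacking the vertex `a` with the greatest label `e` splits a ranked tree: wherever the guard
that moves to `a` comes from, the tree loses the label `e`, or a child of `a` becomes the root of
a tree of its own with smaller labels. (If the guard comes from the parent of the whole branch,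
which requires `a` to be its root, nothing is claimed.) -/
theorem Branch.attack {G : SimpleGraph V} (hG : G.IsTree) {D : Finset V} {p v : V} {x e : ℕ}
    (h : Branch G D p v x) (hp : G.Adj p v ∨ p = v) (he : x.testBit e = true)
    (hmax : ∀ b, x.testBit b = true → b ≤ e) :
    ∃ a ∉ D, InBranch G p v a ∧ ∀ u ∈ D, G.Adj a u → u = p ∧ a = v ∨
      (∃ w x', Branch G (insert a (D.erase u)) w w x' ∧ x' < 2 ^ e) ∨
      (∃ x', Branch G (insert a (D.erase u)) p v x' ∧
        ∀ b, x'.testBit b = true → x.testBit b = true ∧ b ≠ e) := by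
  induction h generalizing e with
  | mk p v w y c x hv hw hb hc ih =>
  by_cases hce : e = c
  · subst hce
    refine ⟨v, hv, inBranch_self hp, fun u hu hvu => ?_⟩
    by_cases hup : u = p
    · exact Or.inl ⟨hup, rfl⟩
    right
    left
    have hC : Child G D p v u := ⟨hu, hvu, hup⟩
    obtain ⟨hadj, hne⟩ := hw u hC
    have hlt : y u < 2 ^ e := by
      refine lt_two_pow_iff_testBit.2 fun b hb' => ?_
      rcases lt_trichotomy b e with h | h | h
      · exact h
      · rw [h, hc.not_mem u hC] at hb'
        exact Bool.noConfusion hb'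
      · exact absurd (hmax b ((hc.testBit_iff b).2 (Or.inr ⟨h, u, hC, hb'⟩))) (by omega)
    suffices h : ∃ x' ≤ y u, Branch G (insert v (D.erase u)) (w u) (w u) x' by
      obtain ⟨x', hx', hbr⟩ := h
      exact ⟨w u, x', hbr, hx'.trans_lt hlt⟩
    refine (hb u hC).restrict hG ?_ ?_ ?_
    · have : w u ∉ D := by
        cases hb u hC
        assumption
      simp [hne, this]
    · intro u'
      simp only [Child, Finset.mem_insert, Finset.mem_erase]
      rintro ⟨h1, h2, -⟩
      have hv' : u' ≠ v := by
        rintro rfl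
        exact not_adj_of_adj_adj hG hadj.symm hvu.symm h2
      rcases h1 with h1 | h1
      · exact (hv' h1).elim
      · exact ⟨h1.2, h2, h1.1⟩
    · intro u₁ w₁ z hu₁ hw₁ hne₁ hz
      have h0 : u₁ ≠ u := by
        rintro rfl
        have := hu₁.1
        simp only [Finset.mem_insert, Finset.mem_erase] at this
        rcases this with h | h
        · exact hvu.ne h.symm
        · exact h.1 rfl
      have hz' := inBranch_of_adj_adj hG (Or.inl hadj) hu₁.2.1 h0 hw₁ hne₁ hz
      have h1 : z ≠ v := by
        rintro rfl
        exact not_inBranch_root hG hvu hadj hne hz'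
      have h2 : z ≠ u := by
        rintro rfl
        exact not_inBranch_left hadj hz'
      simp [h1, h2]
  · obtain h | ⟨hlt, u₀, hC₀, heu⟩ := (hc.testBit_iff e).1 he
    · exact (hce h).elim
    obtain ⟨hadj₀, hne₀⟩ := hw u₀ hC₀
    obtain ⟨a, haD, hain, ha⟩ := ih u₀ hC₀ (Or.inl hadj₀) heu (fun b hb' => by
      rcases le_or_gt b c with h | h
      · omega
      · exact hmax b ((hc.testBit_iff b).2 (Or.inr ⟨h, u₀, hC₀, hb'⟩)))
    refine ⟨a, haD, inBranch_of_adj_adj hG hp hC₀.2.1 hC₀.2.2 hadj₀ hne₀ hain,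
      fun u hu hau => Or.inr ?_⟩
    have hva : v ≠ a := by
      rintro rfl
      exact not_inBranch_root hG hC₀.2.1 hadj₀ hne₀ hain
    have hvD' : v ∉ insert a (D.erase u) := by
      simp [hva, hv]
    -- the branches of the other children are disjoint from the one that contains `a`
    have hother : ∀ u₁ w₁ z, Child G D p v u₁ → u₁ ≠ u₀ → G.Adj u₁ w₁ → w₁ ≠ v →
        InBranch G u₁ w₁ z → ¬ InBranch G u₀ (w u₀) z := by
      intro u₁ w₁ z hu₁ hne hw₁ hw₁v hz
      exact not_inBranch_of_ne hG hu₁.2.1 hC₀.2.1 hne hw₁ hw₁v hadj₀ hne₀ hz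
    rcases InBranch.adj hG hadj₀ hain hau with hin | ⟨rfl, rfl⟩
    · have hagree : ∀ z, ¬ InBranch G u₀ (w u₀) z →
          (z ∈ D ↔ z ∈ insert a (D.erase u)) := by
        intro z hz
        have h1 : z ≠ a := by rintro rfl; exact hz hain
        have h2 : z ≠ u := by rintro rfl; exact hz hin
        simp [h1, h2]
      rcases ha u hu hau with ⟨rfl, rfl⟩ | h | ⟨x', hx', hsub⟩
      · exact (not_inBranch_left hadj₀ hin).elim
      · exact Or.inl h
      right
      have hS : Child G (insert a (D.erase u)) p v = Child G D p v := by
        funext u'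
        simp only [Child, eq_iff_iff]
        refine ⟨fun ⟨h1, h2, h3⟩ => ⟨(hagree u' ?_).2 h1, h2, h3⟩,
          fun ⟨h1, h2, h3⟩ => ⟨(hagree u' ?_).1 h1, h2, h3⟩⟩ <;>
        exact not_inBranch_neighbor hG hC₀.2.1 h2 hadj₀ hne₀
      have hsub' : ∀ u' b, (Function.update y u₀ x' u').testBit b = true →
          (y u').testBit b = true := by
        intro u' b hb'
        by_cases h : u' = u₀
        · subst h
          rw [Function.update_self] at hb'
          exact (hsub b hb').1
        · rwa [Function.update_of_ne h] at hb'
      obtain ⟨x₂, hcomb⟩ := hc.exists_mask (fun _ h => h) hsub'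
      refine ⟨x₂, Branch.mk p v w (Function.update y u₀ x') c _ hvD' ?_ ?_ (hS ▸ hcomb), ?_⟩
      · rw [hS]
        exact hw
      · rw [hS]
        intro u' hu'
        by_cases h : u' = u₀
        · subst h
          rw [Function.update_self]
          exact hx'
        · rw [Function.update_of_ne h]
          exact (hb u' hu').congr hG (Or.inl (hw u' hu').1) fun z hz =>
            hagree z (hother u' _ z hu' h (hw u' hu').1 (hw u' hu').2 hz)
      · intro b hb'
        rcases (hcomb.testBit_iff b).1 hb' with h | ⟨h, u', hu', hb''⟩
        · exact ⟨(hc.testBit_iff b).2 (Or.inl h), by omega⟩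
        · refine ⟨(hc.testBit_iff b).2 (Or.inr ⟨h, u', hu', hsub' _ _ hb''⟩), ?_⟩
          rintro rfl
          by_cases h : u' = u₀
          · subst h
            rw [Function.update_self] at hb''
            exact (hsub b hb'').2 rfl
          · exact hc.disj u' u₀ hu' hC₀ h b hlt (hsub' _ _ hb'') heu
    -- the guard next to `v` moves away from `v`: the branch beyond it is cut off
    · right
      have hagree : ∀ z, z ≠ u → ¬ InBranch G u (w u) z →
          (z ∈ D ↔ z ∈ insert (w u) (D.erase u)) := by
        intro z h2 hz
        have h1 : z ≠ w u := by rintro rfl; exact hz hain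
        simp [h1, h2]
      have hS : ∀ u', Child G (insert (w u) (D.erase u)) p v u' ↔
          Child G D p v u' ∧ u' ≠ u := by
        intro u'
        simp only [Child]
        constructor
        · rintro ⟨h1, h2, h3⟩
          have hne : u' ≠ u := by
            rintro rfl
            simp only [Finset.mem_insert, Finset.mem_erase, ne_eq, not_true_eq_false,
              false_and, or_false] at h1
            exact haD (h1 ▸ hu)
          exact ⟨⟨(hagree u' hne
            (not_inBranch_neighbor hG hC₀.2.1 h2 hadj₀ hne₀)).2 h1, h2, h3⟩, hne⟩
        · rintro ⟨⟨h1, h2, h3⟩, hne⟩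
          exact ⟨(hagree u' hne
            (not_inBranch_neighbor hG hC₀.2.1 h2 hadj₀ hne₀)).1 h1, h2, h3⟩
      obtain ⟨x', hx'⟩ := hc.exists_mask
        (S' := Child G (insert (w u) (D.erase u)) p v) (fun u' h => ((hS u').1 h).1)
        fun _ _ h => h
      refine ⟨x', Branch.mk p v w y c x' hvD' (fun u' h => hw u' ((hS u').1 h).1) ?_ hx', ?_⟩
      · intro u' hu'
        obtain ⟨hu1, hne⟩ := (hS u').1 hu'
        refine (hb u' hu1).congr hG (Or.inl (hw u' hu1).1) fun z hz => hagree z ?_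
          (hother u' _ z hu1 hne (hw u' hu1).1 (hw u' hu1).2 hz)
        rintro rfl
        exact not_inBranch_neighbor hG hu1.2.1 hC₀.2.1 (hw u' hu1).1 (hw u' hu1).2 hz
      · intro b hb'
        rcases (hx'.testBit_iff b).1 hb' with h | ⟨h, u', hu', hb''⟩
        · exact ⟨(hc.testBit_iff b).2 (Or.inl h), by omega⟩
        · obtain ⟨hu1, hne⟩ := (hS u').1 hu'
          refine ⟨(hc.testBit_iff b).2 (Or.inr ⟨h, u', hu1, hb''⟩), ?_⟩
          rintro rfl
          exact hc.disj u' u hu1 hC₀ hne b hlt hb'' heu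

theorem Branch.wins {G : SimpleGraph V} (hG : G.IsTree) {t : ℕ} {D : Finset V} {v : V} {x : ℕ}
    (h : Branch G D v v x) (hx : x < 2 ^ t) : Wins G t D := by
  induction t generalizing D v x with
  | zero =>
    obtain rfl : x = 0 := by simpa using hx
    cases h with
    | mk _ _ w y c _ hv hw hb hc =>
      have := hc.label_mem
      simp at this
  | succ t ih =>
    by_cases ht : x.testBit t = true
    · obtain ⟨a, haD, -, ha⟩ := h.attack hG (Or.inr rfl) ht fun b hb =>
        Nat.lt_succ_iff.1 (lt_two_pow_iff_testBit.1 hx b hb)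
      refine ⟨a, haD, fun u hu hau => ?_⟩
      rcases ha u hu hau with ⟨rfl, rfl⟩ | ⟨w, x', hx', hlt⟩ | ⟨x', hx', hsub⟩
      · exact (hau.ne rfl).elim
      · exact ih hx' hlt
      · refine ih hx' (lt_two_pow_iff_testBit.2 fun b hb => ?_)
        have h1 := lt_two_pow_iff_testBit.1 hx b (hsub b hb).1
        have h2 := (hsub b hb).2
        omega
    · refine (ih h (lt_two_pow_iff_testBit.2 fun b hb => ?_)).succ
      have h1 := lt_two_pow_iff_testBit.1 hx b hb
      have h2 : b ≠ t := by
        rintro rfl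
        exact ht hb
      omega

end Branch

/-! ### Undoing a move -/

section Reroot

variable {V : Type*} [DecidableEq V]

/-- All labels below a vertex being less than `c`, it can have the label `c`, and nothing else is
visible. -/
theorem combine_two_pow {ι : Type*} {S : ι → Prop} {y : ι → ℕ} {c : ℕ}
    (h : ∀ u, S u → y u < 2 ^ c) : Combine S y c (2 ^ c) := by
  refine ⟨fun u hu => Nat.testBit_lt_two_pow (h u hu), ?_, fun b => ?_⟩
  · intro u _ hu _ _ b hb hb' _
    have := lt_two_pow_iff_testBit.1 (h u hu) b hb'
    omega
  · rw [Nat.testBit_two_pow, decide_eq_true_iff]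
    constructor
    · exact fun h => Or.inl h.symm
    · rintro (h' | ⟨h', u, hu, hb⟩)
      · exact h'.symm
      · have := lt_two_pow_iff_testBit.1 (h u hu) b hb
        omega

/-- A ranked tree that exists after the guard on `u` has moved to `a` can be turned into a ranked
tree that exists before the move, or into one that is rooted at a neighbour of `u` and avoids
`u` and `a`. -/
theorem Branch.before_move {G : SimpleGraph V} (hG : G.IsTree) {D : Finset V} {a u v : V}
    {x t : ℕ} (ha : a ∉ D) (hu : u ∈ D) (hau : G.Adj a u)
    (h : Branch G (insert a (D.erase u)) v v x) (hx : x < 2 ^ t) :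
    (∃ v', ∃ x' < 2 ^ t, Branch G D v' v' x') ∨
      ∃ w, ∃ x' < 2 ^ t, G.Adj u w ∧ w ≠ a ∧ Branch G D u w x' := by
  obtain ⟨k, hk⟩ : ∃ k, G.dist v u = k := ⟨_, rfl⟩
  induction k using Nat.strong_induction_on generalizing v x with
  | _ k ih =>
  have hdiff : ∀ z, z ≠ a → z ≠ u → (z ∈ insert a (D.erase u) ↔ z ∈ D) := by
    intro z h1 h2
    simp [h1, h2]
  have haD' : a ∈ insert a (D.erase u) := Finset.mem_insert_self _ _
  have huD' : u ∉ insert a (D.erase u) := by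
    simp [hau.ne']
  have hvD' : v ∉ insert a (D.erase u) := by
    cases h
    assumption
  have hva : v ≠ a := by
    rintro rfl
    exact hvD' haD'
  have hnotD : ∀ z, z ∉ insert a (D.erase u) → z ≠ u → z ∉ D := by
    intro z h1 h2 h3
    exact h1 (by simp [h2, h3])
  by_cases hvu : G.Adj u v
  · right
    obtain ⟨x', hx', hbr⟩ := h.restrict hG (D' := D) (p' := u) (hnotD v hvD' hvu.ne')
      (by
        rintro u' ⟨h1, h2, h3⟩
        refine ⟨(hdiff u' ?_ h3).2 h1, h2, h2.ne'⟩
        rintro rfl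
        exact ha h1)
      (by
        rintro u' w z ⟨h1, h2, h3⟩ hw hwv hz
        refine hdiff z ?_ ?_
        · rintro rfl
          exact h3 (InBranch.eq_of_adj hG h2 hvu.symm
            (InBranch.of_adj hG (Or.inl h2) hw hwv hz)
            (inBranch_neighbor hG (Or.inl hvu.symm) hau.symm hva.symm))
        · rintro rfl
          exact not_inBranch_neighbor hG h2 hvu.symm hw hwv hz)
    exact ⟨v, x', hx'.trans_lt hx, hvu, hva, hbr⟩
  -- a child of the guard on `a` other than `u` is the root of a tree that does not need this guard
  have hcut : ∀ z p x', G.Adj a z → z ≠ u → z ∉ insert a (D.erase u) → (p = z ∨ p = a) →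
      Branch G (insert a (D.erase u)) p z x' → x' < 2 ^ t →
      ∃ v', ∃ x' < 2 ^ t, Branch G D v' v' x' := by
    intro z p x' haz hzu hz hp hbr hlt
    obtain ⟨x'', hx'', hbr'⟩ := hbr.restrict hG (D' := D) (p' := z) (hnotD z hz hzu)
      (by
        rintro u' ⟨h1, h2, h3⟩
        have hu'a : u' ≠ a := by
          rintro rfl
          exact ha h1
        have hu'u : u' ≠ u := by
          rintro rfl
          exact not_adj_of_adj_adj hG haz.symm hau h2
        refine ⟨(hdiff u' hu'a hu'u).2 h1, h2, ?_⟩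
        rcases hp with rfl | rfl
        · exact h3
        · exact hu'a)
      (by
        rintro u' w b ⟨h1, h2, h3⟩ hw hwz hb
        refine hdiff b ?_ ?_
        · rintro rfl
          exact not_inBranch_neighbor hG h2 haz.symm hw hwz hb
        · rintro rfl
          have := InBranch.eq_of_adj hG h2 haz.symm (InBranch.of_adj hG (Or.inl h2) hw hwz hb)
            (inBranch_neighbor hG (Or.inl haz.symm) hau hzu.symm)
          exact ha (this ▸ h1))
    exact ⟨z, x'', hx''.trans_lt hlt, hbr'⟩
  by_cases hav : G.Adj a v
  · left
    by_cases hvu' : v = u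
    · subst hvu'
      cases h with
      | mk _ _ w y c _ hv hw hb hc =>
      have hC : Child G (insert a (D.erase v)) v v a := ⟨haD', hau.symm, hav.ne⟩
      have hbr := hb a hC
      obtain ⟨hw1, hw2⟩ := hw a hC
      refine hcut (w a) a (y a) hw1 hw2 ?_ (Or.inr rfl) hbr (hc.child_lt hx hC)
      cases hbr
      assumption
    · exact hcut v v x hav hvu' hvD' (Or.inl rfl) h hx
  have hvu' : v ≠ u := by
    rintro rfl
    exact hav hau
  -- the neighbour `g` of `v` towards `u`
  obtain ⟨g, hvg, hg⟩ := exists_closer hG hvu'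
  have hug : InBranch G v g u := Or.inr hg
  have hag : InBranch G v g a := by
    rcases InBranch.adj hG hvg hug hau.symm with h | ⟨h, -⟩
    · exact h
    · exact (hva h.symm).elim
  have hgu : g ≠ u := by
    rintro rfl
    exact hvu hvg.symm
  have hga : g ≠ a := by
    rintro rfl
    exact hav hvg.symm
  cases h with
  | mk _ _ w y c _ hv hw hb hc =>
  by_cases hC : Child G (insert a (D.erase u)) v v g ∧ InBranch G g (w g) u
  · obtain ⟨hC, hin⟩ := hC
    obtain ⟨x', hx', hbr⟩ := Branch.reroot hv hw hb hc hx hC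
    refine ih _ ?_ hbr hx' rfl
    rcases hin with hin | hin
    · exact ((hw g hC).1.ne hin).elim
    · omega
  · left
    have hS : Child G D v v = Child G (insert a (D.erase u)) v v := by
      funext u'
      simp only [Child, eq_iff_iff]
      have : G.Adj v u' → (u' ∈ insert a (D.erase u) ↔ u' ∈ D) := by
        intro hadj
        refine hdiff u' ?_ ?_
        · rintro rfl
          exact hav hadj.symm
        · rintro rfl
          exact hvu hadj.symm
      tauto
    refine ⟨v, x, hx, Branch.mk v v w y c x (hnotD v hvD' hvu') (hS ▸ hw) (hS ▸ ?_) (hS ▸ hc)⟩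
    intro u' hu'
    obtain ⟨hw1, hw2⟩ := hw u' hu'
    have hunot : ¬ InBranch G u' (w u') u := by
      intro hin
      have := InBranch.eq_of_adj hG hvg hu'.2.1 hug
        (InBranch.of_adj hG (Or.inl hu'.2.1) hw1 hw2 hin)
      subst this
      exact hC ⟨hu', hin⟩
    refine (hb u' hu').congr hG (Or.inl hw1) fun z hz => hdiff z ?_ ?_
    · rintro rfl
      rcases InBranch.adj hG hw1 hz hau with h | ⟨rfl, -⟩
      · exact hunot h
      · exact hvu hu'.2.1.symm
    · rintro rfl
      exact hunot hz

theorem Wins.exists_branch {G : SimpleGraph V} (hG : G.IsTree) {t : ℕ} {D : Finset V}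
    (h : Wins G t D) : ∃ v, ∃ x < 2 ^ t, Branch G D v v x := by
  classical
  induction t generalizing D with
  | zero => exact h.elim
  | succ t ih =>
    obtain ⟨a, ha, h⟩ := h
    by_cases hD : ∃ v, ∃ x < 2 ^ t, Branch G D v v x
    · obtain ⟨v, x, hx, hbr⟩ := hD
      exact ⟨v, x, hx.trans (Nat.pow_lt_pow_right (by norm_num) (Nat.lt_succ_self t)), hbr⟩
    have key : ∀ u, Child G D a a u →
        ∃ w, ∃ x' < 2 ^ t, G.Adj u w ∧ w ≠ a ∧ Branch G D u w x' := by
      rintro u ⟨hu, hau, -⟩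
      obtain ⟨v, x, hx, hbr⟩ := ih (h u hu hau)
      exact (hbr.before_move hG ha hu hau hx).resolve_left hD
    choose! w x hx hadj hne hbr using key
    refine ⟨a, 2 ^ t, Nat.pow_lt_pow_right (by norm_num) (Nat.lt_succ_self t),
      Branch.mk a a w x t _ ha (fun u hu => ⟨hadj u hu, hne u hu⟩) hbr
        (combine_two_pow hx)⟩

/-- Attacker wins within `t` turns if and only if there is a ranked tree with labels less
than `t`. -/
theorem wins_iff {G : SimpleGraph V} (hG : G.IsTree) {t : ℕ} {D : Finset V} :
    Wins G t D ↔ ∃ v, ∃ x < 2 ^ t, Branch G D v v x :=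
  ⟨fun h => h.exists_branch hG, fun ⟨_, _, hx, h⟩ => h.wins hG hx⟩

end Reroot

/-! ### Least masks -/

section Merge

/-- The greatest number that is less than every mask visible from a vertex whose children `S` have
the masks `y`: the digits of the `y`, and all digits up to the greatest one shared by two of
them. -/
noncomputable def merge {ι : Type*} (N : ℕ) (S : ι → Prop) (y : ι → ℕ) : ℕ :=
  mask N fun b => (∃ u, S u ∧ (y u).testBit b = true) ∨ ∃ b', b ≤ b' ∧ b' < N ∧
    ∃ u u', S u ∧ S u' ∧ u ≠ u' ∧ (y u).testBit b' = true ∧ (y u').testBit b' = true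

theorem exists_testBit_succ (x : ℕ) : ∃ c, x.testBit c = false ∧
    (∀ b, (x + 1).testBit b = true ↔ b = c ∨ c < b ∧ x.testBit b = true) := by
  induction x using Nat.strong_induction_on with
  | _ x ih =>
  rcases Nat.even_or_odd' x with ⟨k, rfl | rfl⟩
  · refine ⟨0, by simp, fun b => ?_⟩
    cases b with
    | zero => simp
    | succ b =>
      rw [Nat.testBit_succ, Nat.testBit_succ, show (2 * k + 1) / 2 = 2 * k / 2 by omega]
      simp
  · obtain ⟨c, hc, h⟩ := ih k (by omega)
    refine ⟨c + 1, ?_, fun b => ?_⟩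
    · rw [Nat.testBit_succ, show (2 * k + 1) / 2 = k by omega, hc]
    · cases b with
      | zero =>
        simp
        omega
      | succ b =>
        rw [Nat.testBit_succ, Nat.testBit_succ, show (2 * k + 1 + 1) / 2 = k + 1 by omega,
          show (2 * k + 1) / 2 = k by omega, h b]
        simp

theorem combine_merge {ι : Type*} {N : ℕ} {S : ι → Prop} {y : ι → ℕ}
    (hy : ∀ u, S u → y u < 2 ^ N) : ∃ c, Combine S y c (merge N S y + 1) := by
  obtain ⟨c, hc, h⟩ := exists_testBit_succ (merge N S y)
  have hbit : ∀ u, S u → ∀ b, (y u).testBit b = true → b < N :=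
    fun u hu => lt_two_pow_iff_testBit.1 (hy u hu)
  have hc' : ¬ (merge N S y).testBit c = true := by simp [hc]
  rw [merge, testBit_mask] at hc'
  have hclash : ∀ u u', S u → S u' → u ≠ u' → ∀ b, c ≤ b → (y u).testBit b = true →
      (y u').testBit b = true → False := by
    intro u u' hu hu' hne b hb h1 h2
    have := hbit u hu b h1
    exact hc' ⟨by omega, Or.inr ⟨b, hb, this, u, u', hu, hu', hne, h1, h2⟩⟩
  refine ⟨c, fun u hu => ?_, fun u u' hu hu' hne b hb => hclash u u' hu hu' hne b hb.le,
    fun b => ?_⟩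
  · by_contra hcon
    rw [Bool.not_eq_false] at hcon
    exact hc' ⟨hbit u hu c hcon, Or.inl ⟨u, hu, hcon⟩⟩
  · rw [h b]
    refine or_congr Iff.rfl (and_congr_right fun hb => ?_)
    rw [merge, testBit_mask]
    constructor
    · rintro ⟨-, h1 | ⟨b', h1, -, u, u', hu, hu', hne, h2, h3⟩⟩
      · exact h1
      · exact (hclash u u' hu hu' hne b' (by omega) h2 h3).elim
    · rintro ⟨u, hu, h1⟩
      exact ⟨hbit u hu b h1, Or.inl ⟨u, hu, h1⟩⟩

/-- If `m ≤ x` and the binary digits agree above position `e`, then `m` has a digit at `e` only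
if `x` has. -/
theorem testBit_of_le_of_agree {m x e : ℕ} (h : m ≤ x)
    (hagree : ∀ b, e < b → m.testBit b = x.testBit b) (he : m.testBit e = true) :
    x.testBit e = true := by
  by_contra hc
  rw [Bool.not_eq_true] at hc
  have := Nat.lt_of_testBit e hc he fun b hb => (hagree b hb).symm
  omega

/-- `merge` is minimal, and monotone in the masks of the children. -/
theorem merge_lt_of_combine {ι : Type*} {N : ℕ} {S : ι → Prop} {m y : ι → ℕ} {c x : ℕ}
    (hm : ∀ u, S u → m u ≤ y u) (hc : Combine S y c x) (hx : x < 2 ^ N) : merge N S m < x := by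
  -- the greatest position `e ≥ c` at which the masks `m` and `y` differ, or `c` if there is none
  obtain ⟨e, he, hmax⟩ : ∃ e, (c ≤ e ∧ (e = c ∨ ∃ u, S u ∧ (m u).testBit e ≠ (y u).testBit e)) ∧
      ∀ b, e < b → ∀ u, S u → (m u).testBit b = (y u).testBit b := by
    classical
    let P : ℕ → Prop := fun e => c ≤ e ∧ (e = c ∨ ∃ u, S u ∧ (m u).testBit e ≠ (y u).testBit e)
    have hbound : ∀ b, P b → b ≤ N + c := by
      rintro b ⟨h1, h2 | ⟨u, hu, h2⟩⟩
      · omega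
      · by_contra hcon
        have h3 := hc.child_lt hx hu
        have h4 := hm u hu
        have h5 : (2 : ℕ) ^ N ≤ 2 ^ b := Nat.pow_le_pow_right (by norm_num) (by omega)
        rw [Nat.testBit_lt_two_pow (by omega), Nat.testBit_lt_two_pow (by omega)] at h2
        exact h2 rfl
    have hPc : P c := ⟨le_rfl, Or.inl rfl⟩
    refine ⟨Nat.findGreatest P (N + c),
      Nat.findGreatest_spec (P := P) (m := c) (by omega) hPc, fun b hb u hu => ?_⟩
    by_contra hne
    have hcb : c ≤ Nat.findGreatest P (N + c) :=
      Nat.le_findGreatest (by omega) hPc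
    have hPb : P b := ⟨by omega, Or.inr ⟨u, hu, hne⟩⟩
    have := Nat.le_findGreatest (hbound b hPb) hPb
    omega
  obtain ⟨hce, hor⟩ := he
  have hle : ∀ u, S u → (m u).testBit e = true → (y u).testBit e = true := fun u hu =>
    testBit_of_le_of_agree (hm u hu) fun b hb => hmax b hb u hu
  have hxe : x.testBit e = true := by
    rw [hc.testBit_iff]
    rcases hor with h | ⟨u, hu, hne⟩
    · exact Or.inl h
    · by_cases h : e = c
      · exact Or.inl h
      · refine Or.inr ⟨by omega, u, hu, ?_⟩
        by_contra hcon
        refine hne ?_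
        by_contra h'
        have h1 : (m u).testBit e = true := by
          rw [Bool.not_eq_true] at hcon
          rw [hcon] at h'
          simpa using h'
        exact hcon (hle u hu h1)
  have hnone : ∀ u, S u → (m u).testBit e = true → False := by
    intro u hu h1
    have h2 := hle u hu h1
    rcases hor with rfl | ⟨u', hu', hne⟩
    · rw [hc.not_mem u hu] at h2
      exact Bool.noConfusion h2
    · by_cases h : e = c
      · rw [h, hc.not_mem u hu] at h2
        exact Bool.noConfusion h2
      have h3 : (y u').testBit e = true := by
        by_contra h4
        refine hne ?_
        by_contra h5
        rw [Bool.not_eq_true] at h4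
        rw [h4, ← ne_eq, Bool.ne_false_iff] at h5
        exact absurd (hle u' hu' h5) (by simp [h4])
      by_cases huu : u = u'
      · subst huu
        exact hne (h1.trans h2.symm)
      · exact hc.disj u u' hu hu' huu e (by omega) h2 h3
  refine Nat.lt_of_testBit e ?_ hxe fun b hb => ?_
  · rw [← Bool.not_eq_true, merge, testBit_mask]
    rintro ⟨-, ⟨u, hu, h1⟩ | ⟨b', hb', -, u, u', hu, hu', hne, h1, h2⟩⟩
    · exact hnone u hu h1
    · rcases Nat.eq_or_lt_of_le hb' with rfl | hlt
      · exact hnone u hu h1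
      · rw [hmax b' hlt u hu] at h1
        rw [hmax b' hlt u' hu'] at h2
        exact hc.disj u u' hu hu' hne b' (by omega) h1 h2
  · rw [Bool.eq_iff_iff, hc.testBit_iff, merge, testBit_mask]
    constructor
    · rintro ⟨-, ⟨u, hu, h1⟩ | ⟨b', hb', -, u, u', hu, hu', hne, h1, h2⟩⟩
      · rw [hmax b hb u hu] at h1
        exact Or.inr ⟨by omega, u, hu, h1⟩
      · rw [hmax b' (by omega) u hu] at h1
        rw [hmax b' (by omega) u' hu'] at h2
        exact (hc.disj u u' hu hu' hne b' (by omega) h1 h2).elim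
    · rintro (h | ⟨h1, u, hu, h2⟩)
      · omega
      · refine ⟨lt_two_pow_iff_testBit.1 hx b
          ((hc.testBit_iff b).2 (Or.inr ⟨h1, u, hu, h2⟩)), Or.inl ⟨u, hu, ?_⟩⟩
        rw [hmax b hb u hu]
        exact h2

end Merge

/-! ### The table of least masks -/

section Table

variable {V : Type*} {G : SimpleGraph V} {D : Finset V}

/-- `b` is the least nonzero entry `T u w` of a table for the neighbours `w ≠ v` of `u`, and `0`
if there is none. -/
structure LeastEntry (G : SimpleGraph V) (T : V → V → ℕ) (v u : V) (b : ℕ) : Prop where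
  attained : b ≠ 0 → ∃ w, G.Adj u w ∧ w ≠ v ∧ T u w = b
  le : ∀ w, G.Adj u w → w ≠ v → T u w ≠ 0 → b ≠ 0 ∧ b ≤ T u w

theorem LeastEntry.unique {T : V → V → ℕ} {v u : V} {b b' : ℕ} (h : LeastEntry G T v u b)
    (h' : LeastEntry G T v u b') : b = b' := by
  have key : ∀ b b', LeastEntry G T v u b → LeastEntry G T v u b' → b ≠ 0 → b' ≠ 0 ∧ b' ≤ b := by
    intro b b' h h' h0
    obtain ⟨w, h1, h2, rfl⟩ := h.attained h0
    exact h'.le w h1 h2 h0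
  have h1 := key b b' h h'
  have h2 := key b' b h' h
  omega

variable [Fintype V]

open Classical in
/-- The number of vertices of a branch. -/
noncomputable def branchCard (G : SimpleGraph V) (p v : V) : ℕ :=
  (Finset.univ.filter (InBranch G p v)).card

theorem branchCard_le (p v : V) : branchCard G p v ≤ Fintype.card V := Finset.card_le_univ _

theorem branchCard_lt (hG : G.IsTree) {p v u w : V} (hp : G.Adj p v ∨ p = v)
    (hu : G.Adj v u) (hup : u ≠ p) (hw : G.Adj u w) (hwv : w ≠ v) :
    branchCard G u w < branchCard G p v := by
  classical
  refine Finset.card_lt_card ((Finset.ssubset_iff_of_subset fun z hz => ?_).2 ⟨v, ?_, ?_⟩)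
  · simp only [Finset.mem_filter, Finset.mem_univ, true_and] at hz ⊢
    exact inBranch_of_adj_adj hG hp hu hup hw hwv hz
  · simpa using inBranch_self hp
  · simpa using not_inBranch_root hG hu hw hwv

/-- Labelling a vertex by its height shows that few labels suffice. -/
theorem Branch.exists_lt (hG : G.IsTree) {p v : V} {x : ℕ} (h : Branch G D p v x)
    (hp : G.Adj p v ∨ p = v) : ∃ x' < 2 ^ branchCard G p v, Branch G D p v x' := by
  induction h with
  | mk p v w y c x hv hw hb hc ih =>
  have key : ∀ u, Child G D p v u →
      ∃ x', x' < 2 ^ (branchCard G p v - 1) ∧ Branch G D u (w u) x' := by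
    intro u hu
    obtain ⟨x', hx', hbr⟩ := ih u hu (Or.inl (hw u hu).1)
    have := branchCard_lt hG hp hu.2.1 hu.2.2 (hw u hu).1 (hw u hu).2
    exact ⟨x', lt_of_lt_of_le hx' (Nat.pow_le_pow_right (by norm_num) (by omega)), hbr⟩
  choose! x' hx' hbr using key
  have hpos : 0 < branchCard G p v :=
    Finset.card_pos.2 ⟨v, by simpa using inBranch_self hp⟩
  exact ⟨_, Nat.pow_lt_pow_right (by norm_num) (by omega),
    Branch.mk p v w x' _ _ hv hw hbr (combine_two_pow hx')⟩

/-- Every nonzero entry of the table is the mask of a ranked tree. -/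
def Sound (G : SimpleGraph V) (D : Finset V) (T : V → V → ℕ) : Prop :=
  ∀ p v, T p v ≠ 0 → T p v < 2 ^ Fintype.card V ∧ Branch G D p v (T p v)

open Classical in
/-- The new entry for the branch at `v` seen from `p`, where `m u` is the least mask of a child
below the guard `u`; it is `0` if there is no ranked tree. -/
noncomputable def newEntry (G : SimpleGraph V) (D : Finset V) (p v : V) (m : V → ℕ) : ℕ :=
  if v ∈ D then 0
  else if ∃ u, Child G D p v u ∧ m u = 0 then 0
  else if merge (Fintype.card V) (Child G D p v) m + 1 < 2 ^ Fintype.card V then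
    merge (Fintype.card V) (Child G D p v) m + 1
  else 0

theorem newEntry_sound {T : V → V → ℕ} (hT : Sound G D T) {p v : V} {m : V → ℕ}
    (hm : ∀ u, Child G D p v u → LeastEntry G T v u (m u)) (h : newEntry G D p v m ≠ 0) :
    newEntry G D p v m < 2 ^ Fintype.card V ∧ Branch G D p v (newEntry G D p v m) := by
  unfold newEntry at h ⊢
  split_ifs at h ⊢ with hv h0 hlt
  · exact (h rfl).elim
  · exact (h rfl).elim
  · refine ⟨hlt, ?_⟩
    push Not at h0
    have key : ∀ u, Child G D p v u → ∃ w, G.Adj u w ∧ w ≠ v ∧ T u w = m u :=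
      fun u hu => (hm u hu).attained (h0 u hu)
    choose! w hadj hne hw using key
    have hs : ∀ u, Child G D p v u → m u < 2 ^ Fintype.card V ∧ Branch G D u (w u) (m u) := by
      intro u hu
      rw [← hw u hu]
      exact hT u (w u) (by rw [hw u hu]; exact h0 u hu)
    obtain ⟨c, hc⟩ := combine_merge fun u hu => (hs u hu).1
    exact Branch.mk p v w m c _ hv (fun u hu => ⟨hadj u hu, hne u hu⟩)
      (fun u hu => (hs u hu).2) hc
  · exact (h rfl).elim

theorem newEntry_le {T : V → V → ℕ} {p v : V} {m : V → ℕ} {x : ℕ}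
    (hm : ∀ u, Child G D p v u → LeastEntry G T v u (m u))
    (h : Branch G D p v x) (hx : x < 2 ^ Fintype.card V)
    (hT : ∀ u w x', Child G D p v u → G.Adj u w → w ≠ v → Branch G D u w x' →
      x' < 2 ^ Fintype.card V → T u w ≠ 0 ∧ T u w ≤ x') :
    newEntry G D p v m ≠ 0 ∧ newEntry G D p v m ≤ x := by
  cases h with
  | mk _ _ w y c _ hv hw hb hc =>
  have key : ∀ u, Child G D p v u → m u ≠ 0 ∧ m u ≤ y u := by
    intro u hu
    obtain ⟨hadj, hne⟩ := hw u hu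
    obtain ⟨h0, h1⟩ := hT u (w u) (y u) hu hadj hne (hb u hu) (hc.child_lt hx hu)
    obtain ⟨h2, h3⟩ := (hm u hu).le (w u) hadj hne h0
    exact ⟨h2, h3.trans h1⟩
  have hlt := merge_lt_of_combine (fun u hu => (key u hu).2) hc hx
  have h0 : ¬ ∃ u, Child G D p v u ∧ m u = 0 := fun ⟨u, hu, h⟩ => (key u hu).1 h
  rw [newEntry, if_neg hv, if_neg h0, if_pos (by omega)]
  omega

/-- After `k` rounds the entries for the branches with at most `k` vertices are lower bounds. -/
def Complete (G : SimpleGraph V) (D : Finset V) (T : V → V → ℕ) (k : ℕ) (p v : V) : Prop :=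
  (G.Adj p v ∨ p = v) → branchCard G p v ≤ k → ∀ x < 2 ^ Fintype.card V, Branch G D p v x →
    T p v ≠ 0 ∧ T p v ≤ x

theorem newEntry_complete (hG : G.IsTree) {T : V → V → ℕ} {p v : V} {m : V → ℕ} {k : ℕ}
    (hm : ∀ u, Child G D p v u → LeastEntry G T v u (m u))
    (hT : ∀ p v, Complete G D T k p v) (hp : G.Adj p v ∨ p = v)
    (hk : branchCard G p v ≤ k + 1) {x : ℕ} (hx : x < 2 ^ Fintype.card V)
    (h : Branch G D p v x) : newEntry G D p v m ≠ 0 ∧ newEntry G D p v m ≤ x := by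
  refine newEntry_le hm h hx fun u w x' hu hadj hne hbr hx' => ?_
  have := branchCard_lt hG hp hu.2.1 hu.2.2 hadj hne
  exact hT u w (Or.inl hadj) (by omega) x' hx' hbr

/-- The table decides the game. -/
theorem wins_iff_table [DecidableEq V] (hG : G.IsTree) {T : V → V → ℕ} (hs : Sound G D T)
    (hc : ∀ p v, Complete G D T (Fintype.card V) p v) {t : ℕ} :
    Wins G t D ↔ ∃ v, T v v ≠ 0 ∧ T v v < 2 ^ min (Fintype.card V) t := by
  rw [wins_iff hG]
  constructor
  · rintro ⟨v, x, hx, h⟩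
    obtain ⟨x', hx', h'⟩ : ∃ x' < 2 ^ min (Fintype.card V) t, Branch G D v v x' := by
      rcases le_total t (Fintype.card V) with ht | ht
      · rw [min_eq_right ht]
        exact ⟨x, hx, h⟩
      · obtain ⟨x', hx', h'⟩ := h.exists_lt hG (Or.inr rfl)
        rw [min_eq_left ht]
        exact ⟨x', hx'.trans_le (Nat.pow_le_pow_right (by norm_num) (branchCard_le v v)), h'⟩
    obtain ⟨h0, hle⟩ := hc v v (Or.inr rfl) (branchCard_le v v) x'
      (hx'.trans_le (Nat.pow_le_pow_right (by norm_num) (min_le_left _ _))) h'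
    exact ⟨v, h0, hle.trans_lt hx'⟩
  · rintro ⟨v, h0, hlt⟩
    exact ⟨v, T v v, hlt.trans_le (Nat.pow_le_pow_right (by norm_num) (min_le_right _ _)),
      (hs v v h0).2⟩

end Table

end EternalDomination

namespace RAM

/-! ### A language of expressions with bounded iteration -/

/-- Expressions for natural numbers. They are evaluated in an environment with a parameter `size`,
the input word, a heap, and local variables, which are numbered from the outermost binder. -/
inductive Expr : Type where
  /-- a constant -/
  | lit (c : ℕ) : Expr
  /-- a local variable -/
  | var (i : ℕ) : Expr
  /-- the parameter -/
  | size : Expr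
  /-- the length of the input -/
  | len : Expr
  /-- sum -/
  | add (a b : Expr) : Expr
  /-- truncated difference -/
  | sub (a b : Expr) : Expr
  /-- the code of the input symbol at a position -/
  | read (a : Expr) : Expr
  /-- the contents of the heap at an address -/
  | load (a : Expr) : Expr
  /-- the value of `b` if the value of `a` is not `0`, and the value of `c` otherwise -/
  | cond (a b c : Expr) : Expr
  /-- the value of `b`, the next variable being bound to the value of `a` -/
  | letE (a b : Expr) : Expr
  /-- iteration of `b`, with the next two variables bound to the current value and to the number of
  preceding steps, starting from the value of `a`; the number of steps is the length of the input
  if `long`, and the parameter `size` otherwise -/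
  | fold (long : Bool) (a b : Expr) : Expr

/-- `N`-fold iteration of `f`, which is also told the number of preceding steps. -/
def iter {α : Type*} (f : ℕ → α → α) (a : α) : ℕ → α
  | 0 => a
  | k + 1 => f k (iter f a k)

/-- The value of an expression: `w` is the input, `n` the parameter, `h` the heap, `m` the number
of bound variables and `ρ` their values. -/
def Expr.eval (w : List Bool) (n : ℕ) (h : ℕ → ℕ) : Expr → ℕ → (ℕ → ℕ) → ℕ
  | lit c, _, _ => c
  | var i, m, ρ => if i < m then ρ i else 0
  | size, _, _ => n
  | len, _, _ => w.length
  | add a b, m, ρ => a.eval w n h m ρ + b.eval w n h m ρ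
  | sub a b, m, ρ => a.eval w n h m ρ - b.eval w n h m ρ
  | read a, m, ρ => symbol w (a.eval w n h m ρ)
  | load a, m, ρ => h (a.eval w n h m ρ)
  | cond a b c, m, ρ => if a.eval w n h m ρ ≠ 0 then b.eval w n h m ρ else c.eval w n h m ρ
  | letE a b, m, ρ => b.eval w n h (m + 1) (Function.update ρ m (a.eval w n h m ρ))
  | fold long a b, m, ρ =>
    iter (fun k acc => b.eval w n h (m + 2) (Function.update (Function.update ρ m acc) (m + 1) k))
      (a.eval w n h m ρ) (if long then w.length else n)

/-- Commands, which change the heap. -/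
inductive Cmd : Type where
  /-- write the value of `e` to the address given by the value of `a` -/
  | store (a e : Expr) : Cmd
  /-- repeat a command `size` times, the next variable being bound to the number of preceding
  steps -/
  | iterate (c : Cmd) : Cmd

/-- The heap after the execution of a command. -/
def Cmd.run (w : List Bool) (n : ℕ) : Cmd → ℕ → (ℕ → ℕ) → (ℕ → ℕ) → (ℕ → ℕ)
  | store a e, m, ρ, h => Function.update h (a.eval w n h m ρ) (e.eval w n h m ρ)
  | .iterate c, m, ρ, h => iter (fun k h => c.run w n (m + 1) (Function.update ρ m k) h) h n

/-! ### Running programs with a time bound -/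

/-- Started with memory `M`, the program `c` halts within `B` steps in a memory satisfying `Q`. -/
def Runs (w : List Bool) (c : Prog) (M : Memory) (B : ℕ) (Q : Memory → Prop) : Prop :=
  ∃ k M', Exec w c M k M' ∧ k ≤ B ∧ Q M'

section Runs

variable {w : List Bool} {M : Memory} {Q R : Memory → Prop} {B B' : ℕ} {a b : Prog}

theorem Runs.seq (ha : Runs w a M B R) (hb : ∀ M', R M' → Runs w b M' B' Q) :
    Runs w (.seq a b) M (B + B') Q := by
  obtain ⟨k, M', h, hk, hR⟩ := ha
  obtain ⟨k', M'', h', hk', hQ⟩ := hb M' hR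
  exact ⟨k + k', M'', .seq h h', by omega, hQ⟩

theorem Runs.mono (h : Runs w a M B R) (hB : B ≤ B') (hQ : ∀ M', R M' → Q M') :
    Runs w a M B' Q := by
  obtain ⟨k, M', h, hk, hR⟩ := h
  exact ⟨k, M', h, by omega, hQ M' hR⟩

theorem runs_const {i c : ℕ} (h : Q (Function.update M i c)) : Runs w (.const i c) M 1 Q :=
  ⟨1, _, .const i c M, le_rfl, h⟩

theorem runs_add {i j k : ℕ} (h : Q (Function.update M i (M j + M k))) :
    Runs w (.add i j k) M 1 Q :=
  ⟨1, _, .add i j k M, le_rfl, h⟩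

theorem runs_sub {i j k : ℕ} (h : Q (Function.update M i (M j - M k))) :
    Runs w (.sub i j k) M 1 Q :=
  ⟨1, _, .sub i j k M, le_rfl, h⟩

theorem runs_load {i j : ℕ} (h : Q (Function.update M i (M (M j)))) :
    Runs w (.load i j) M 1 Q :=
  ⟨1, _, .load i j M, le_rfl, h⟩

theorem runs_store {i j : ℕ} (h : Q (Function.update M (M i) (M j))) :
    Runs w (.store i j) M 1 Q :=
  ⟨1, _, .store i j M, le_rfl, h⟩

theorem runs_read {i j : ℕ} (h : Q (Function.update M i (symbol w (M j)))) :
    Runs w (.read i j) M 1 Q :=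
  ⟨1, _, .read i j M, le_rfl, h⟩

theorem runs_ite {i : ℕ} (ha : M i ≠ 0 → Runs w a M B Q) (hb : M i = 0 → Runs w b M B Q) :
    Runs w (.ite i a b) M (B + 1) Q := by
  by_cases hi : M i = 0
  · obtain ⟨k, M', h, hk, hQ⟩ := hb hi
    exact ⟨k + 1, M', .ite_false hi h, by omega, hQ⟩
  · obtain ⟨k, M', h, hk, hQ⟩ := ha hi
    exact ⟨k + 1, M', .ite_true hi h, by omega, hQ⟩

/-- A loop whose control register decreases by one in every round. -/
theorem runs_loop {i : ℕ} {I : ℕ → Memory → Prop} {r : ℕ}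
    (hI : ∀ r M, I r M → M i = r)
    (hstep : ∀ r M, I (r + 1) M → Runs w a M B (I r)) (h : I r M) :
    Runs w (.loop i a) M (r * (B + 1) + 1) (I 0) := by
  induction r generalizing M with
  | zero => exact ⟨1, M, Exec.loop_stop (hI 0 M h), by omega, h⟩
  | succ r ih =>
    obtain ⟨k, M', h1, hk, hI'⟩ := hstep r M h
    obtain ⟨k', M'', h2, hk', hI''⟩ := ih hI'
    refine ⟨k + k' + 1, M'', .loop_step (by rw [hI _ _ h]; omega) h1 h2, ?_, hI''⟩
    have : (r + 1) * (B + 1) = r * (B + 1) + (B + 1) := by ring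
    omega

/-- `M[i] := M[j]` -/
def move (i j : ℕ) : Prog := .seq (.const i 0) (.add i i j)

theorem runs_move {i j : ℕ} (hij : j ≠ i) (h : Q (Function.update M i (M j))) :
    Runs w (move i j) M 2 Q := by
  refine Runs.mono (B := 1 + 1) ?_ le_rfl fun _ h => h
  refine (runs_const (Q := fun M' => M' = Function.update M i 0) rfl).seq ?_
  rintro _ rfl
  refine runs_add ?_
  simpa [Function.update_of_ne hij] using h

end Runs

/-! ### Compilation -/

/-- The program computing the value of an expression below `m` binders. The result is left in
register `4 * d + 8`. The parameter is in register `2`, the length of the input in register `4`,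
variable `i` in register `4 * i + 6` and the heap cell `a` in register `2 * a + 1`; the registers
`4 * j + 8` with `j ≥ d` serve as a stack of intermediate results. -/
def Expr.compile : Expr → ℕ → ℕ → Prog
  | lit c, _, d => .const (4 * d + 8) c
  | var i, m, d => if i < m then move (4 * d + 8) (4 * i + 6) else .const (4 * d + 8) 0
  | size, _, d => move (4 * d + 8) 2
  | len, _, d => move (4 * d + 8) 4
  | add a b, m, d => .seq (a.compile m d) (.seq (b.compile m (d + 1))
      (.add (4 * d + 8) (4 * d + 8) (4 * d + 12)))
  | sub a b, m, d => .seq (a.compile m d) (.seq (b.compile m (d + 1))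
      (.sub (4 * d + 8) (4 * d + 8) (4 * d + 12)))
  | read a, m, d => .seq (a.compile m d) (.read (4 * d + 8) (4 * d + 8))
  | load a, m, d => .seq (a.compile m d) (.seq (.const (4 * d + 12) 1)
      (.seq (.add (4 * d + 8) (4 * d + 8) (4 * d + 8))
        (.seq (.add (4 * d + 8) (4 * d + 8) (4 * d + 12)) (.load (4 * d + 8) (4 * d + 8)))))
  | cond a b c, m, d => .seq (a.compile m d) (.ite (4 * d + 8) (b.compile m d) (c.compile m d))
  | letE a b, m, d => .seq (a.compile m d) (.seq (move (4 * m + 6) (4 * d + 8))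
      (b.compile (m + 1) d))
  | fold long a b, m, d => .seq (a.compile m d) (.seq (move (4 * m + 6) (4 * d + 8))
      (.seq (move (4 * d + 8) (if long then 4 else 2))
        (.seq (.loop (4 * d + 8)
          (.seq (.sub (4 * m + 10) (if long then 4 else 2) (4 * d + 8))
            (.seq (b.compile (m + 2) (d + 1))
              (.seq (move (4 * m + 6) (4 * d + 12))
                (.seq (.const (4 * d + 12) 1)
                  (.sub (4 * d + 8) (4 * d + 8) (4 * d + 12)))))))
          (move (4 * d + 8) (4 * m + 6)))))

/-- A bound for the running time of a compiled expression in terms of the length of the input. -/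
noncomputable def Expr.cost : Expr → Polynomial ℕ
  | lit _ => 1
  | var _ => 2
  | size => 2
  | len => 2
  | add a b => a.cost + (b.cost + 1)
  | sub a b => a.cost + (b.cost + 1)
  | read a => a.cost + 1
  | load a => a.cost + 4
  | cond a b c => a.cost + (b.cost + c.cost + 1)
  | letE a b => a.cost + (2 + b.cost)
  | fold _ a b => a.cost + (4 + (Polynomial.X * (b.cost + 6) + 3))

/-- The memory represents the parameter, the length of the input, the heap and the variables. -/
structure Rep (w : List Bool) (n : ℕ) (h : ℕ → ℕ) (m : ℕ) (ρ : ℕ → ℕ) (M : Memory) : Prop where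
  size : M 2 = n
  len : M 4 = w.length
  heap : ∀ a, M (2 * a + 1) = h a
  var : ∀ i < m, M (4 * i + 6) = ρ i

/-- The memories agree except for variables from `m` on and intermediate results from `d` on. -/
def Keep (m d : ℕ) (M M' : Memory) : Prop :=
  ∀ r, r % 2 = 1 ∨ r < 6 ∨ r % 4 = 2 ∧ r < 4 * m + 6 ∨ r % 4 = 0 ∧ r < 4 * d + 8 → M' r = M r

theorem Keep.trans {m d m' d' : ℕ} {M M' M'' : Memory} (h : Keep m d M M')
    (h' : Keep m' d' M' M'') (hm : m ≤ m') (hd : d ≤ d') : Keep m d M M'' := fun r hr => by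
  rw [h' r (by omega), h r hr]

theorem Keep.update {m d r : ℕ} {M M' : Memory} (h : Keep m d M M')
    (hr : r % 4 = 2 ∧ 4 * m + 6 ≤ r ∨ r % 4 = 0 ∧ 4 * d + 8 ≤ r) (x : ℕ) :
    Keep m d M (Function.update M' r x) := fun s hs => by
  rw [Function.update_of_ne (by omega), h s hs]

theorem Keep.refl (m d : ℕ) (M : Memory) : Keep m d M M := fun _ _ => rfl

theorem Rep.keep {w : List Bool} {n : ℕ} {h : ℕ → ℕ} {m d : ℕ} {ρ : ℕ → ℕ} {M M' : Memory}
    (hM : Rep w n h m ρ M) (hk : Keep m d M M') : Rep w n h m ρ M' where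
  size := by rw [hk 2 (by omega), hM.size]
  len := by rw [hk 4 (by omega), hM.len]
  heap a := by rw [hk _ (by omega), hM.heap]
  var i hi := by rw [hk _ (by omega), hM.var i hi]

theorem Rep.push {w : List Bool} {n : ℕ} {h : ℕ → ℕ} {m : ℕ} {ρ : ℕ → ℕ} {M : Memory}
    (hM : Rep w n h m ρ M) {x : ℕ} (hx : M (4 * m + 6) = x) :
    Rep w n h (m + 1) (Function.update ρ m x) M where
  size := hM.size
  len := hM.len
  heap := hM.heap
  var i hi := by
    rcases Nat.lt_succ_iff_lt_or_eq.1 hi with h | rfl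
    · rw [Function.update_of_ne (by omega), hM.var i h]
    · rw [Function.update_self, hx]

theorem Expr.runs_compile {w : List Bool} {n : ℕ} {h : ℕ → ℕ} (hn : n ≤ w.length) (e : Expr) :
    ∀ (m d : ℕ) (ρ : ℕ → ℕ) (M : Memory), Rep w n h m ρ M →
      Runs w (e.compile m d) M (e.cost.eval w.length)
        fun M' => M' (4 * d + 8) = e.eval w n h m ρ ∧ Keep m d M M' := by
  induction e with
  | lit c =>
    intro m d ρ M hM
    refine (runs_const ⟨Function.update_self _ _ _, (Keep.refl m d M).update (by omega) _⟩).mono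
      (by simp [cost]) fun _ h => h
  | var i =>
    intro m d ρ M hM
    by_cases hi : i < m
    · simp only [compile, eval, if_pos hi]
      refine (runs_move (by omega) ⟨?_, (Keep.refl m d M).update (by omega) _⟩).mono
        (by simp [cost]) fun _ h => h
      rw [Function.update_self, hM.var i hi]
    · simp only [compile, eval, if_neg hi]
      exact (runs_const ⟨Function.update_self _ _ _, (Keep.refl m d M).update (by omega) _⟩).mono
        (by simp [cost]) fun _ h => h
  | size =>
    intro m d ρ M hM
    refine (runs_move (by omega) ⟨?_, (Keep.refl m d M).update (by omega) _⟩).mono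
      (by simp [cost]) fun _ h => h
    rw [Function.update_self, hM.size, eval]
  | len =>
    intro m d ρ M hM
    refine (runs_move (by omega) ⟨?_, (Keep.refl m d M).update (by omega) _⟩).mono
      (by simp [cost]) fun _ h => h
    rw [Function.update_self, hM.len, eval]
  | add a b iha ihb =>
    intro m d ρ M hM
    simp only [cost, Polynomial.eval_add, Polynomial.eval_one]
    refine (iha m d ρ M hM).seq fun M₁ ⟨h1, hk1⟩ => ?_
    refine (ihb m (d + 1) ρ M₁ (hM.keep hk1)).seq fun M₂ ⟨h2, hk2⟩ => ?_
    refine runs_add ⟨?_, (hk1.trans hk2 le_rfl (by omega)).update (by omega) _⟩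
    rw [Function.update_self, hk2 _ (by omega), h1, show 4 * d + 12 = 4 * (d + 1) + 8 by ring, h2,
      eval]
  | sub a b iha ihb =>
    intro m d ρ M hM
    simp only [cost, Polynomial.eval_add, Polynomial.eval_one]
    refine (iha m d ρ M hM).seq fun M₁ ⟨h1, hk1⟩ => ?_
    refine (ihb m (d + 1) ρ M₁ (hM.keep hk1)).seq fun M₂ ⟨h2, hk2⟩ => ?_
    refine runs_sub ⟨?_, (hk1.trans hk2 le_rfl (by omega)).update (by omega) _⟩
    rw [Function.update_self, hk2 _ (by omega), h1, show 4 * d + 12 = 4 * (d + 1) + 8 by ring, h2,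
      eval]
  | read a iha =>
    intro m d ρ M hM
    simp only [cost, Polynomial.eval_add, Polynomial.eval_one]
    refine (iha m d ρ M hM).seq fun M₁ ⟨h1, hk1⟩ => ?_
    refine runs_read ⟨?_, hk1.update (by omega) _⟩
    rw [Function.update_self, h1, eval]
  | load a iha =>
    intro m d ρ M hM
    simp only [cost, Polynomial.eval_add, Polynomial.eval_ofNat]
    refine (iha m d ρ M hM).seq fun M₁ ⟨h1, hk1⟩ => ?_
    refine Runs.mono (B := 1 + (1 + (1 + 1))) ?_ (by omega) fun _ h => h
    refine (runs_const (Q := fun M' => M' = Function.update M₁ (4 * d + 12) 1) rfl).seq ?_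
    rintro M₂ rfl
    refine (runs_add (Q := fun M' => M' (4 * d + 8) = 2 * a.eval w n h m ρ ∧
      M' (4 * d + 12) = 1 ∧ Keep m d M M') ⟨?_, ?_, ?_⟩).seq ?_
    · rw [Function.update_self, Function.update_of_ne (by omega), h1]
      ring
    · rw [Function.update_of_ne (by omega), Function.update_self]
    · exact (hk1.update (by omega) _).update (by omega) _
    rintro M₃ ⟨h2, h3, hk3⟩
    refine (runs_add (Q := fun M' => M' (4 * d + 8) = 2 * a.eval w n h m ρ + 1 ∧ Keep m d M M')
      ⟨?_, hk3.update (by omega) _⟩).seq ?_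
    · rw [Function.update_self, h2, h3]
    rintro M₄ ⟨h4, hk4⟩
    refine runs_load ⟨?_, hk4.update (by omega) _⟩
    rw [Function.update_self, h4, (hM.keep hk4).heap, eval]
  | cond a b c iha ihb ihc =>
    intro m d ρ M hM
    simp only [cost, Polynomial.eval_add, Polynomial.eval_one]
    refine (iha m d ρ M hM).seq fun M₁ ⟨h1, hk1⟩ => ?_
    refine runs_ite (fun h0 => ?_) fun h0 => ?_
    · refine (ihb m d ρ M₁ (hM.keep hk1)).mono (by omega) fun M₂ ⟨h2, hk2⟩ =>
        ⟨?_, hk1.trans hk2 le_rfl le_rfl⟩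
      rw [h2, eval, if_pos (h1 ▸ h0)]
    · refine (ihc m d ρ M₁ (hM.keep hk1)).mono (by omega) fun M₂ ⟨h2, hk2⟩ =>
        ⟨?_, hk1.trans hk2 le_rfl le_rfl⟩
      rw [h2, eval, if_neg (by rw [← h1, h0]; simp)]
  | letE a b iha ihb =>
    intro m d ρ M hM
    simp only [cost, Polynomial.eval_add, Polynomial.eval_ofNat]
    refine (iha m d ρ M hM).seq fun M₁ ⟨h1, hk1⟩ => ?_
    refine (runs_move (Q := fun M' => M' (4 * m + 6) = a.eval w n h m ρ ∧ Keep m d M M')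
      (by omega) ⟨?_, hk1.update (by omega) _⟩).seq fun M₂ ⟨h2, hk2⟩ => ?_
    · rw [Function.update_self, h1]
    refine (ihb (m + 1) d _ M₂ ((hM.keep hk2).push h2)).mono le_rfl fun M₃ ⟨h3, hk3⟩ =>
      ⟨?_, hk2.trans hk3 (by omega) le_rfl⟩
    rw [h3, eval]
  | fold long a b iha ihb =>
    intro m d ρ M hM
    simp only [cost, Polynomial.eval_add, Polynomial.eval_mul, Polynomial.eval_X,
      Polynomial.eval_ofNat]
    obtain ⟨N, hN⟩ : ∃ N, N = if long then w.length else n := ⟨_, rfl⟩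
    obtain ⟨reg, hreg⟩ : ∃ reg, reg = if long then 4 else 2 := ⟨_, rfl⟩
    have hreg' : ∀ M', Rep w n h m ρ M' → M' reg = N := by
      intro M' hM'
      cases long
      · simp only [Bool.false_eq_true, if_false] at hN hreg
        rw [hreg, hM'.size, hN]
      · simp only [if_true] at hN hreg
        rw [hreg, hM'.len, hN]
    have hreg6 : reg = 4 ∨ reg = 2 := by
      cases long <;> simp_all
    have hNl : N ≤ w.length := by
      cases long <;> simp_all
    let f := fun k acc =>
      b.eval w n h (m + 2) (Function.update (Function.update ρ m acc) (m + 1) k)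
    simp only [compile, eval, ← hreg, ← hN]
    refine (iha m d ρ M hM).seq fun M₁ ⟨h1, hk1⟩ => ?_
    refine Runs.mono (B := 2 + (2 + (N * (b.cost.eval w.length + 5 + 1) + 1 + 2))) ?_ ?_
      fun _ h => h
    · refine (runs_move (Q := fun M' => M' (4 * m + 6) = a.eval w n h m ρ ∧ Keep m d M M')
        (by omega) ⟨?_, hk1.update (by omega) _⟩).seq fun M₂ ⟨h2, hk2⟩ => ?_
      · rw [Function.update_self, h1]
      let I : ℕ → Memory → Prop := fun r M' => M' (4 * d + 8) = r ∧ r ≤ N ∧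
        M' (4 * m + 6) = iter f (a.eval w n h m ρ) (N - r) ∧ Keep m d M M'
      refine (runs_move (Q := I N) (by omega) ⟨?_, le_rfl, ?_, hk2.update (by omega) _⟩).seq
        fun M₃ hI₃ => ?_
      · rw [Function.update_self, hreg' M₂ (hM.keep hk2)]
      · rw [Function.update_of_ne (by omega), h2, Nat.sub_self, iter]
      refine (runs_loop (I := I) (fun r M' hI => hI.1) (fun r M' hI => ?_) hI₃).seq
        fun M₄ ⟨_, _, h4, hk4⟩ => ?_
      · obtain ⟨hd, hrN, hacc, hk⟩ := hI
        refine Runs.mono (B := 1 + (b.cost.eval w.length + (2 + (1 + 1)))) ?_ (by omega)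
          fun _ h => h
        refine (runs_sub (Q := fun M' => M' (4 * d + 8) = r + 1 ∧ M' (4 * m + 10) = N - (r + 1) ∧
          M' (4 * m + 6) = iter f (a.eval w n h m ρ) (N - (r + 1)) ∧ Keep m d M M')
          ⟨?_, ?_, ?_, hk.update (by omega) _⟩).seq fun M₅ ⟨h5, h6, h7, hk5⟩ => ?_
        · rw [Function.update_of_ne (by omega), hd]
        · rw [Function.update_self, hreg' M' (hM.keep hk), hd]
        · rw [Function.update_of_ne (by omega), hacc]
        refine (ihb (m + 2) (d + 1) _ M₅ (((hM.keep hk5).push h7).push (x := N - (r + 1))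
          (by rw [← h6, show 4 * (m + 1) + 6 = 4 * m + 10 by ring]))).seq fun M₆ ⟨h8, hk6⟩ => ?_
        refine (runs_move (Q := fun M' => M' (4 * d + 8) = r + 1 ∧
          M' (4 * m + 6) = iter f (a.eval w n h m ρ) (N - r) ∧ Keep m d M M')
          (by omega) ⟨?_, ?_, ?_⟩).seq fun M₇ ⟨h9, h10, hk7⟩ => ?_
        · rw [Function.update_of_ne (by omega), hk6 _ (by omega), h5]
        · rw [Function.update_self, show 4 * d + 12 = 4 * (d + 1) + 8 by ring, h8,
            show N - r = N - (r + 1) + 1 by omega, iter]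
        · exact (hk5.trans hk6 (by omega) (by omega)).update (by omega) _
        refine (runs_const (Q := fun M' => M' = Function.update M₇ (4 * d + 12) 1) rfl).seq ?_
        rintro _ rfl
        refine runs_sub ⟨?_, by omega, ?_, (hk7.update (by omega) _).update (by omega) _⟩
        · rw [Function.update_self, Function.update_self, Function.update_of_ne (by omega), h9]
          rfl
        · rw [Function.update_of_ne (by omega), Function.update_of_ne (by omega), h10]
      · refine runs_move (by omega) ⟨?_, hk4.update (by omega) _⟩
        rw [Function.update_self, h4]
        rfl
    · have := Nat.mul_le_mul_right (b.cost.eval w.length + 6) hNl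
      rw [show b.cost.eval w.length + 5 + 1 = b.cost.eval w.length + 6 from rfl]
      omega

/-- The program executing a command below `m` binders, with the intermediate results from `d`
on. -/
def Cmd.compile : Cmd → ℕ → ℕ → Prog
  | store a e, m, d => .seq (a.compile m d) (.seq (e.compile m (d + 1))
      (.seq (.const (4 * d + 16) 1) (.seq (.add (4 * d + 8) (4 * d + 8) (4 * d + 8))
        (.seq (.add (4 * d + 8) (4 * d + 8) (4 * d + 16)) (.store (4 * d + 8) (4 * d + 12))))))
  | .iterate c, m, d => .seq (move (4 * d + 8) 2) (.loop (4 * d + 8)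
      (.seq (.sub (4 * m + 6) 2 (4 * d + 8)) (.seq (c.compile (m + 1) (d + 1))
        (.seq (.const (4 * d + 12) 1) (.sub (4 * d + 8) (4 * d + 8) (4 * d + 12))))))

/-- A bound for the running time of a compiled command in terms of the length of the input. -/
noncomputable def Cmd.cost : Cmd → Polynomial ℕ
  | store a e => a.cost + (e.cost + 4)
  | .iterate c => 2 + (Polynomial.X * (c.cost + 4) + 1)

/-- The memories agree on everything but the heap, the variables from `m` on and the intermediate
results from `d` on. -/
def KeepStack (m d : ℕ) (M M' : Memory) : Prop :=
  ∀ r, r % 2 = 0 ∧ r < 6 ∨ r % 4 = 2 ∧ r < 4 * m + 6 ∨ r % 4 = 0 ∧ r < 4 * d + 8 → M' r = M r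

theorem Rep.keepStack {w : List Bool} {n : ℕ} {h h' : ℕ → ℕ} {m d : ℕ} {ρ : ℕ → ℕ}
    {M M' : Memory} (hM : Rep w n h m ρ M) (hk : KeepStack m d M M')
    (hh : ∀ a, M' (2 * a + 1) = h' a) : Rep w n h' m ρ M' where
  size := by rw [hk 2 (by omega), hM.size]
  len := by rw [hk 4 (by omega), hM.len]
  heap := hh
  var i hi := by rw [hk _ (by omega), hM.var i hi]

theorem Cmd.runs_compile {w : List Bool} {n : ℕ} (hn : n ≤ w.length) (c : Cmd) :
    ∀ (m d : ℕ) (ρ h : ℕ → ℕ) (M : Memory), Rep w n h m ρ M →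
      Runs w (c.compile m d) M (c.cost.eval w.length)
        fun M' => (∀ a, M' (2 * a + 1) = c.run w n m ρ h a) ∧ KeepStack m d M M' := by
  induction c with
  | store a e =>
    intro m d ρ h M hM
    simp only [cost, Polynomial.eval_add, Polynomial.eval_ofNat]
    refine (a.runs_compile hn m d ρ M hM).seq fun M₁ ⟨h1, hk1⟩ => ?_
    refine (e.runs_compile hn m (d + 1) ρ M₁ (hM.keep hk1)).seq fun M₂ ⟨h2, hk2⟩ => ?_
    have hk2' := hk1.trans hk2 le_rfl (Nat.le_succ d)
    refine Runs.mono (B := 1 + (1 + (1 + 1))) ?_ (by omega) fun _ h => h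
    refine (runs_const (Q := fun M' => M' = Function.update M₂ (4 * d + 16) 1) rfl).seq ?_
    rintro _ rfl
    refine (runs_add (Q := fun M' => M' (4 * d + 8) = 2 * a.eval w n h m ρ ∧
      M' (4 * d + 12) = e.eval w n h m ρ ∧ M' (4 * d + 16) = 1 ∧ Keep m d M M')
      ⟨?_, ?_, ?_, (hk2'.update (by omega) _).update (by omega) _⟩).seq
      fun M₃ ⟨h3, h4, h5, hk3⟩ => ?_
    · rw [Function.update_self, Function.update_of_ne (by omega), hk2 _ (by omega), h1]
      ring
    · rw [Function.update_of_ne (by omega), Function.update_of_ne (by omega),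
        show 4 * d + 12 = 4 * (d + 1) + 8 by ring, h2]
    · rw [Function.update_of_ne (by omega), Function.update_self]
    refine (runs_add (Q := fun M' => M' (4 * d + 8) = 2 * a.eval w n h m ρ + 1 ∧
      M' (4 * d + 12) = e.eval w n h m ρ ∧ Keep m d M M')
      ⟨?_, ?_, hk3.update (by omega) _⟩).seq fun M₄ ⟨h6, h7, hk4⟩ => ?_
    · rw [Function.update_self, h3, h5]
    · rw [Function.update_of_ne (by omega), h4]
    refine runs_store ⟨fun b => ?_, fun r hr => ?_⟩
    · rw [h6, h7, run]
      by_cases hb : b = a.eval w n h m ρ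
      · rw [hb, Function.update_self, Function.update_self]
      · rw [Function.update_of_ne (by omega), Function.update_of_ne hb, (hM.keep hk4).heap]
    · rw [h6, Function.update_of_ne (by omega), hk4 r (by omega)]
  | iterate c ih =>
    intro m d ρ h M hM
    simp only [cost, Polynomial.eval_add, Polynomial.eval_mul, Polynomial.eval_X,
      Polynomial.eval_ofNat, Polynomial.eval_one]
    let f := fun k h => c.run w n (m + 1) (Function.update ρ m k) h
    let I : ℕ → Memory → Prop := fun r M' => M' (4 * d + 8) = r ∧ r ≤ n ∧
      (∀ a, M' (2 * a + 1) = iter f h (n - r) a) ∧ KeepStack m d M M'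
    refine Runs.mono (B := 2 + (n * (c.cost.eval w.length + 3 + 1) + 1)) ?_ ?_ fun _ h => h
    · refine (runs_move (Q := I n) (by omega) ⟨?_, le_rfl, fun a => ?_, fun r hr => ?_⟩).seq
        fun M₁ hI₁ => ?_
      · rw [Function.update_self, hM.size]
      · rw [Function.update_of_ne (by omega), hM.heap, Nat.sub_self, iter]
      · rw [Function.update_of_ne (by omega)]
      refine (runs_loop (I := I) (fun r M' hI => hI.1) (fun r M' hI => ?_) hI₁).mono le_rfl
        fun M₂ hI => ⟨hI.2.2.1, hI.2.2.2⟩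
      obtain ⟨hd, hrn, hh, hk⟩ := hI
      have hM' := hM.keepStack hk hh
      refine Runs.mono (B := 1 + (c.cost.eval w.length + (1 + 1))) ?_ (by omega) fun _ h => h
      refine (runs_sub (Q := fun M' => M' (4 * d + 8) = r + 1 ∧ M' (4 * m + 6) = n - (r + 1) ∧
        (∀ a, M' (2 * a + 1) = iter f h (n - (r + 1)) a) ∧ KeepStack m d M M')
        ⟨?_, ?_, fun a => ?_, fun s hs => ?_⟩).seq fun M₃ ⟨h1, h2, h3, hk3⟩ => ?_
      · rw [Function.update_of_ne (by omega), hd]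
      · rw [Function.update_self, hM'.size, hd]
      · rw [Function.update_of_ne (by omega), hh]
      · rw [Function.update_of_ne (by omega), hk s hs]
      refine (ih (m + 1) (d + 1) _ _ M₃ ((hM.keepStack hk3 h3).push h2)).seq
        fun M₄ ⟨h4, hk4⟩ => ?_
      refine (runs_const (Q := fun M' => M' = Function.update M₄ (4 * d + 12) 1) rfl).seq ?_
      rintro _ rfl
      refine runs_sub ⟨?_, by omega, fun a => ?_, fun s hs => ?_⟩
      · rw [Function.update_self, Function.update_self, Function.update_of_ne (by omega),
          hk4 _ (by omega), h1]
        rfl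
      · rw [Function.update_of_ne (by omega), Function.update_of_ne (by omega), h4,
          show n - r = n - (r + 1) + 1 by omega, iter]
      · rw [Function.update_of_ne (by omega), Function.update_of_ne (by omega),
          hk4 _ (by omega), hk3 s hs]
    · have := Nat.mul_le_mul_right (c.cost.eval w.length + 4) hn
      rw [show c.cost.eval w.length + 3 + 1 = c.cost.eval w.length + 4 from rfl]
      omega

theorem symbol_eq_zero_iff {w : List Bool} {p : ℕ} : symbol w p = 0 ↔ w.length ≤ p := by
  rw [← List.getElem?_eq_none_iff, symbol]
  rcases w[p]? with _ | _ | _ <;> simp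

/-- The program that leaves the length of the input in register `4`. -/
def lengthProg : Prog :=
  .seq (.read 8 4) (.loop 8 (.seq (.const 12 1) (.seq (.add 4 4 12) (.read 8 4))))

theorem runs_lengthProg (w : List Bool) :
    Runs w lengthProg (fun _ => 0) (5 * w.length + 2)
      fun M => M 4 = w.length ∧ ∀ r, r < 4 ∨ r % 2 = 1 → M r = 0 := by
  have loop : ∀ k M, M 4 + k = w.length → M 8 = symbol w (M 4) →
      (∀ r, r < 4 ∨ r % 2 = 1 → M r = 0) →
      Runs w (.loop 8 (.seq (.const 12 1) (.seq (.add 4 4 12) (.read 8 4)))) M (5 * k + 1)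
        fun M => M 4 = w.length ∧ ∀ r, r < 4 ∨ r % 2 = 1 → M r = 0 := by
    intro k
    induction k with
    | zero =>
      intro M h4 h8 h0
      exact ⟨1, M, Exec.loop_stop (by rw [h8, symbol_eq_zero_iff]; omega), by omega, h4, h0⟩
    | succ k ih =>
      intro M h4 h8 h0
      have hne : M 8 ≠ 0 := by
        rw [h8, ne_eq, symbol_eq_zero_iff]
        omega
      have hstep : Runs w (.seq (.const 12 1) (.seq (.add 4 4 12) (.read 8 4))) M (1 + (1 + 1))
          fun M' => M' 4 = M 4 + 1 ∧ M' 8 = symbol w (M' 4) ∧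
            ∀ r, r < 4 ∨ r % 2 = 1 → M' r = 0 := by
        refine (runs_const (Q := fun M' => M' = Function.update M 12 1) rfl).seq ?_
        rintro _ rfl
        refine (runs_add (Q := fun M' => M' = Function.update (Function.update M 12 1) 4
          (M 4 + 1)) ?_).seq ?_
        · simp
        rintro _ rfl
        refine runs_read ⟨by simp, by simp, fun r hr => ?_⟩
        rw [Function.update_of_ne (by omega), Function.update_of_ne (by omega),
          Function.update_of_ne (by omega), h0 r hr]
      obtain ⟨k₁, M₁, he₁, hk₁, h1, h2, h3⟩ := hstep
      obtain ⟨k₂, M₂, he₂, hk₂, hQ⟩ := ih M₁ (by omega) h2 h3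
      exact ⟨k₁ + k₂ + 1, M₂, .loop_step hne he₁ he₂, by omega, hQ⟩
  refine Runs.mono (B := 1 + (5 * w.length + 1)) ?_ (by omega) fun _ h => h
  refine (runs_read (Q := fun M' => M' 4 = 0 ∧ M' 8 = symbol w (M' 4) ∧
    ∀ r, r < 4 ∨ r % 2 = 1 → M' r = 0) ⟨by simp, by simp, fun r hr => ?_⟩).seq
    fun M ⟨h4, h8, h0⟩ => loop _ M (by omega) h8 h0
  rw [Function.update_of_ne (by omega)]

/-- What can be computed by expressions and commands can be computed by a program in polynomial
time: compute the parameter `n`, execute the command `c`, and evaluate the expression `e` in the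
resulting heap. -/
theorem exists_prog (s : Expr) (c : Cmd) (e : Expr) :
    ∃ (prog : Prog) (p : Polynomial ℕ), ∀ (w : List Bool) (n : ℕ),
      s.eval w 0 (fun _ => 0) 0 (fun _ => 0) = n → n ≤ w.length →
      Runs w prog (fun _ => 0) (p.eval w.length) fun M =>
        M 0 = e.eval w n (c.run w n 0 (fun _ => 0) fun _ => 0) 0 fun _ => 0 := by
  refine ⟨.seq lengthProg (.seq (s.compile 0 0) (.seq (move 2 8) (.seq (c.compile 0 0)
    (.seq (e.compile 0 0) (move 0 8))))),
    (5 * Polynomial.X + 2) + (s.cost + (2 + (c.cost + (e.cost + 2)))), fun w n hs hn => ?_⟩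
  simp only [Polynomial.eval_add, Polynomial.eval_mul, Polynomial.eval_X, Polynomial.eval_ofNat]
  refine (runs_lengthProg w).seq fun M₁ ⟨h1, h2⟩ => ?_
  have hM₁ : Rep w 0 (fun _ => 0) 0 (fun _ => 0) M₁ :=
    ⟨h2 2 (by omega), h1, fun a => h2 _ (by omega), fun i hi => by omega⟩
  refine (s.runs_compile (Nat.zero_le _) 0 0 _ M₁ hM₁).seq fun M₂ ⟨h3, hk2⟩ => ?_
  have hM₂ := hM₁.keep hk2
  refine (runs_move (Q := Rep w n (fun _ => 0) 0 fun _ => 0) (by omega)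
    ⟨?_, ?_, fun a => ?_, fun i hi => by omega⟩).seq fun M₃ hM₃ => ?_
  · rw [Function.update_self, ← hs, ← h3]
  · rw [Function.update_of_ne (by omega), hM₂.len]
  · rw [Function.update_of_ne (by omega), hM₂.heap]
  refine (c.runs_compile hn 0 0 _ _ M₃ hM₃).seq fun M₄ ⟨h4, hk4⟩ => ?_
  refine (e.runs_compile hn 0 0 _ M₄ (hM₃.keepStack hk4 h4)).seq fun M₅ ⟨h5, _⟩ => ?_
  refine runs_move (by omega) ?_
  rw [Function.update_self, ← h5]

/-! ### Iteration -/

section Iter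

theorem iter_induction {α : Type*} {f : ℕ → α → α} {a : α} {N : ℕ} (P : ℕ → α → Prop)
    (h0 : P 0 a) (hs : ∀ k < N, ∀ x, P k x → P (k + 1) (f k x)) : P N (iter f a N) := by
  have : ∀ k ≤ N, P k (iter f a k) := by
    intro k
    induction k with
    | zero => exact fun _ => h0
    | succ k ih => exact fun hk => hs k hk _ (ih (by omega))
  exact this N le_rfl

theorem iter_sum {N : ℕ} {g : ℕ → ℕ → ℕ} {f : Fin N → ℕ} {a : ℕ}
    (h : ∀ (k : Fin N) acc, g k acc = acc + f k) : iter g a N = a + ∑ k, f k := by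
  induction N with
  | zero => simp [iter]
  | succ N ih =>
    rw [iter, Fin.sum_univ_castSucc, ih (f := fun k => f k.castSucc) fun k => h k.castSucc,
      ← Nat.add_assoc]
    exact h (Fin.last N) _

open Classical in
theorem iter_exists {N : ℕ} {g : ℕ → ℕ → ℕ} {P : Fin N → Prop}
    (h : ∀ (k : Fin N) acc, g k acc = if P k then 1 else acc) :
    iter g 0 N = if ∃ k, P k then 1 else 0 := by
  induction N with
  | zero => simp [iter]
  | succ N ih =>
    rw [iter, ih (P := fun k => P k.castSucc) fun k => h k.castSucc]
    refine (h (Fin.last N) _).trans ?_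
    simp only [Fin.exists_fin_succ']
    by_cases h1 : P (Fin.last N) <;> simp [h1]

variable {ρ : ℕ → ℕ} {m x a b : ℕ}

theorem push_of_lt (h : x < m) : Function.update ρ m a x = ρ x :=
  Function.update_of_ne h.ne _ _

theorem push2_of_lt (h : x < m) :
    Function.update (Function.update ρ m a) (m + 1) b x = ρ x := by
  rw [Function.update_of_ne (by omega), Function.update_of_ne (by omega)]

theorem push2_fst : Function.update (Function.update ρ m a) (m + 1) b m = a := by
  rw [Function.update_of_ne (by omega), Function.update_self]

end Iter

/-! ### Arithmetic expressions -/

namespace Expr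

variable {w : List Bool} {n : ℕ} {h : ℕ → ℕ} {ρ : ℕ → ℕ} {m x y b : ℕ}

theorem eval_var_of_lt (hx : x < m) : (var x).eval w n h m ρ = ρ x := if_pos hx

theorem eval_cond_pos {a b c : Expr} (ha : a.eval w n h m ρ ≠ 0) :
    (cond a b c).eval w n h m ρ = b.eval w n h m ρ := if_pos ha

theorem eval_cond_neg {a b c : Expr} (ha : ¬ a.eval w n h m ρ ≠ 0) :
    (cond a b c).eval w n h m ρ = c.eval w n h m ρ := if_neg ha

theorem eval_fold_false {a b : Expr} : (fold false a b).eval w n h m ρ =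
    iter (fun k acc => b.eval w n h (m + 2)
      (Function.update (Function.update ρ m acc) (m + 1) k)) (a.eval w n h m ρ) n := rfl

theorem eval_letE {a b : Expr} {v : ℕ} (hv : a.eval w n h m ρ = v) :
    (letE a b).eval w n h m ρ = b.eval w n h (m + 1) (Function.update ρ m v) := by
  rw [← hv, eval]

/-- the product of the parameter and a variable -/
def mulE (m x : ℕ) : Expr := fold false (lit 0) (add (var m) (var x))

theorem eval_mulE (hx : x < m) : (mulE m x).eval w n h m ρ = n * ρ x := by
  rw [mulE, eval, if_neg Bool.false_ne_true, iter_sum (f := fun _ => ρ x)]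
  · simp [eval]
  · intro k acc
    simp [eval, push2_of_lt hx, show x < m + 2 by omega]

/-- the square of the parameter -/
def sqE (m : ℕ) : Expr := fold false (lit 0) (add (var m) size)

theorem eval_sqE : (sqE m).eval w n h m ρ = n * n := by
  rw [sqE, eval, if_neg Bool.false_ne_true, iter_sum (f := fun _ => n)]
  · simp [eval]
  · intro k acc
    simp [eval]

/-- the power of two with a variable as its exponent, capped at the number of steps -/
def powE (long : Bool) (m x : ℕ) : Expr :=
  fold long (lit 1) (cond (sub (var x) (var (m + 1))) (add (var m) (var m)) (var m))

theorem eval_powE {long : Bool} (hx : x < m) :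
    (powE long m x).eval w n h m ρ = 2 ^ min (if long then w.length else n) (ρ x) := by
  rw [powE, eval]
  refine iter_induction (fun k acc => acc = 2 ^ min k (ρ x)) (by simp [eval]) fun k _ acc hacc => ?_
  simp only [eval, push2_of_lt hx, push2_fst, show x < m + 2 by omega, show m < m + 2 by omega,
    show m + 1 < m + 2 by omega, if_true, Function.update_self]
  split_ifs with hk
  · rw [hacc, min_eq_left (by omega), min_eq_left (by omega), pow_succ]
    ring
  · rw [hacc, min_eq_right (by omega), min_eq_right (by omega)]

/-- the power of two whose exponent is the parameter -/
def powSizeE (m : ℕ) : Expr := letE size (powE false (m + 1) m)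

theorem eval_powSizeE : (powSizeE m).eval w n h m ρ = 2 ^ n := by
  rw [powSizeE, eval, eval_powE (Nat.lt_succ_self m), Function.update_self]
  simp [eval]

/-- The binary digit of variable `x` whose position is variable `b`: subtract the powers of two
that occur in `x` at higher positions. -/
def bitE (m x b : ℕ) : Expr :=
  letE (fold false (var x) (letE (sub (sub size (lit 1)) (var (m + 1)))
      (cond (sub (var (m + 2)) (var b))
        (letE (powE false (m + 3) (m + 2))
          (cond (sub (add (var m) (lit 1)) (var (m + 3))) (sub (var m) (var (m + 3))) (var m)))
        (var m))))
    (letE (powE false (m + 1) b) (cond (sub (add (var m) (lit 1)) (var (m + 1))) (lit 1) (lit 0)))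

theorem mod_two_pow_succ (x j : ℕ) :
    x % 2 ^ (j + 1) = x % 2 ^ j + 2 ^ j * (x.testBit j).toNat := by
  rw [Nat.mod_pow_succ, Nat.toNat_testBit]

theorem mod_two_pow_step (x j : ℕ) :
    (if x % 2 ^ (j + 1) + 1 - 2 ^ j ≠ 0 then x % 2 ^ (j + 1) - 2 ^ j else x % 2 ^ (j + 1)) =
      x % 2 ^ j := by
  have h1 := mod_two_pow_succ x j
  have h2 := Nat.mod_lt x (Nat.two_pow_pos j)
  cases hb : x.testBit j
  · rw [hb] at h1
    simp only [Bool.toNat_false, mul_zero, add_zero] at h1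
    rw [if_neg (by omega), h1]
  · rw [hb] at h1
    simp only [Bool.toNat_true, mul_one] at h1
    rw [if_pos (by omega)]
    omega

theorem eval_bitE (hx : x < m) (hb : b < m) (hxn : ρ x < 2 ^ n) (hbn : ρ b < n) :
    (bitE m x b).eval w n h m ρ = if (ρ x).testBit (ρ b) then 1 else 0 := by
  rw [bitE, eval]
  have key : (fold false (var x) (letE (sub (sub size (lit 1)) (var (m + 1)))
      (cond (sub (var (m + 2)) (var b))
        (letE (powE false (m + 3) (m + 2))
          (cond (sub (add (var m) (lit 1)) (var (m + 3))) (sub (var m) (var (m + 3))) (var m)))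
        (var m)))).eval w n h m ρ = ρ x % 2 ^ (ρ b + 1) := by
    rw [eval, if_neg Bool.false_ne_true]
    have := iter_induction (N := n) (a := ρ x)
      (f := fun k acc => if n - 1 - k - ρ b ≠ 0 then
        if acc + 1 - 2 ^ (n - 1 - k) ≠ 0 then acc - 2 ^ (n - 1 - k) else acc else acc)
      (fun k acc => acc = ρ x % 2 ^ max (n - k) (ρ b + 1)) ?_ ?_
    · rw [Nat.sub_self, Nat.zero_max] at this
      rw [← this, eval_var_of_lt hx]
      congr 1
      funext k acc
      have hpow : min n (n - 1 - k) = n - 1 - k := by omega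
      simp [eval, eval_powE, hpow, show m ≤ m + 2 + 1 by omega,
        show m ≠ m + 2 + 1 by omega, show b < m + 2 + 1 by omega, show b ≠ m + 2 by omega,
        show b ≠ m + 1 by omega,
        show b ≠ m by omega]
    · rw [max_eq_left (by omega), Nat.sub_zero, Nat.mod_eq_of_lt hxn]
    · rintro k hk acc rfl
      by_cases h1 : n - 1 - k - ρ b ≠ 0
      · have h2 : max (n - k) (ρ b + 1) = n - 1 - k + 1 := by omega
        have h3 : max (n - (k + 1)) (ρ b + 1) = n - 1 - k := by omega
        rw [if_pos h1, h2, h3]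
        exact mod_two_pow_step _ _
      · rw [if_neg h1]
        congr 2
        omega
  rw [key]
  have h1 := mod_two_pow_succ (ρ x) (ρ b)
  have h2 := Nat.mod_lt (ρ x) (Nat.two_pow_pos (ρ b))
  have h3 : min n (ρ b) = ρ b := by omega
  simp only [eval, eval_powE (show b < m + 1 by omega), push_of_lt hb, push2_fst,
    Function.update_self, show m < m + 1 + 1 by omega, show m + 1 < m + 1 + 1 by omega, if_true,
    Bool.false_eq_true, if_false, h3]
  cases hbit : (ρ x).testBit (ρ b)
  · rw [hbit] at h1
    simp only [Bool.toNat_false, mul_zero, add_zero] at h1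
    rw [if_neg (by omega), if_neg Bool.false_ne_true]
  · rw [hbit] at h1
    simp only [Bool.toNat_true, mul_one] at h1
    rw [if_pos (by omega), if_pos rfl]

end Expr

end RAM

namespace EternalDomination

open RAM RAM.Expr

/-! ### The algorithm -/

/-- The word `w` contains the graph `G` on `n` vertices, the set `D` of guards and the number `t`
at the positions used by `Instance.encode`. -/
structure Encodes (w : List Bool) {n : ℕ} (G : SimpleGraph (Fin n)) (D : Finset (Fin n))
    (t : ℕ) : Prop where
  adj : ∀ a b : Fin n, symbol w (n + 1 + n * a + b) - 1 ≠ 0 ↔ G.Adj a b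
  guard : ∀ a : Fin n, symbol w (n + 1 + n * n + a) - 1 ≠ 0 ↔ a ∈ D
  time : ∀ k, symbol w (n + 1 + n * n + n + k) - 1 ≠ 0 ↔ t.testBit k = true
  time_lt : t < 2 ^ w.length

/-- The table stored in the heap. -/
def table (n : ℕ) (h : ℕ → ℕ) (p v : Fin n) : ℕ := h (n * p + v)

section Expr

variable {w : List Bool} {n : ℕ} {G : SimpleGraph (Fin n)} {D : Finset (Fin n)} {t : ℕ}
  {h : ℕ → ℕ} {ρ : ℕ → ℕ} {m : ℕ}

/-- are the vertices `x` and `y` adjacent? -/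
def adjE (m x y : ℕ) : Expr :=
  letE (mulE m x) (sub (read (add (add (add size (lit 1)) (var m)) (var y))) (lit 1))

theorem eval_adjE (hw : Encodes w G D t) {x y : ℕ} {a b : Fin n} (hx : x < m) (hy : y < m)
    (ha : ρ x = a) (hb : ρ y = b) : (adjE m x y).eval w n h m ρ ≠ 0 ↔ G.Adj a b := by
  rw [← hw.adj]
  simp [adjE, eval, eval_mulE hx, push_of_lt hy, show y < m + 1 by omega, ha, hb]

/-- does the vertex `x` carry a guard? -/
def guardE (m x : ℕ) : Expr :=
  letE (sqE m) (sub (read (add (add (add size (lit 1)) (var m)) (var x))) (lit 1))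

theorem eval_guardE (hw : Encodes w G D t) {x : ℕ} {a : Fin n} (hx : x < m) (ha : ρ x = a) :
    (guardE m x).eval w n h m ρ ≠ 0 ↔ a ∈ D := by
  rw [← hw.guard]
  simp [guardE, eval, eval_sqE, push_of_lt hx, show x < m + 1 by omega, ha]

/-- the entry of the table for the pair `x`, `y` -/
def tableE (m x y : ℕ) : Expr := letE (mulE m x) (load (add (var m) (var y)))

theorem eval_tableE {x y : ℕ} {a b : Fin n} (hx : x < m) (hy : y < m)
    (ha : ρ x = a) (hb : ρ y = b) : (tableE m x y).eval w n h m ρ = table n h a b := by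
  simp [tableE, eval, eval_mulE hx, push_of_lt hy, show y < m + 1 by omega, ha, hb, table]

/-- are the vertices `x` and `y` different? -/
def neE (x y : ℕ) : Expr := add (sub (var x) (var y)) (sub (var y) (var x))

theorem eval_neE {x y : ℕ} {a b : Fin n} (hx : x < m) (hy : y < m)
    (ha : ρ x = a) (hb : ρ y = b) : (neE x y).eval w n h m ρ ≠ 0 ↔ a ≠ b := by
  simp only [neE, eval, if_pos hx, if_pos hy, ha, hb, ne_eq a b, Fin.ext_iff]
  omega

/-- is `u` a guard next to `v`, other than `p`? -/
def childE (m p v u : ℕ) : Expr :=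
  cond (guardE m u) (cond (adjE m v u) (neE u p) (lit 0)) (lit 0)

theorem eval_childE (hw : Encodes w G D t) {p v u : ℕ} {a b c : Fin n} (hp : p < m) (hv : v < m)
    (hu : u < m) (ha : ρ p = a) (hb : ρ v = b) (hc : ρ u = c) :
    (childE m p v u).eval w n h m ρ ≠ 0 ↔ Child G D a b c := by
  rw [childE, Child]
  by_cases h1 : c ∈ D
  · rw [eval_cond_pos ((eval_guardE hw hu hc).2 h1)]
    by_cases h2 : G.Adj b c
    · rw [eval_cond_pos ((eval_adjE hw hv hu hb hc).2 h2), eval_neE hu hp hc ha]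
      simp [h1, h2]
    · rw [eval_cond_neg (mt (eval_adjE hw hv hu hb hc).1 h2)]
      simp [eval, h2]
  · rw [eval_cond_neg (mt (eval_guardE hw hu hc).1 h1)]
    simp [eval, h1]

/-- the smaller one of the nonzero values `a` and `b` -/
def minNonzero (a b : ℕ) : ℕ :=
  if a ≠ 0 then if b ≠ 0 then if a - b ≠ 0 then b else a else a else b

/-- the least nonzero entry of the table below the guard `u` next to `v` -/
def leastE (m v u : ℕ) : Expr :=
  fold false (lit 0) (letE (tableE (m + 2) u (m + 1))
    (cond (adjE (m + 3) u (m + 1)) (cond (neE (m + 1) v)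
      (cond (var m) (cond (var (m + 2)) (cond (sub (var m) (var (m + 2))) (var (m + 2)) (var m))
        (var m)) (var (m + 2))) (var m)) (var m)))

theorem leastEntry_leastE (hw : Encodes w G D t) {v u : ℕ} {b c : Fin n} (hv : v < m)
    (hu : u < m) (hb : ρ v = b) (hc : ρ u = c) :
    LeastEntry G (table n h) b c ((leastE m v u).eval w n h m ρ) := by
  classical
  rw [leastE, eval_fold_false]
  have step : ∀ (k : Fin n) acc, (letE (tableE (m + 2) u (m + 1))
      (cond (adjE (m + 3) u (m + 1)) (cond (neE (m + 1) v)
        (cond (var m) (cond (var (m + 2)) (cond (sub (var m) (var (m + 2))) (var (m + 2)) (var m))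
          (var m)) (var (m + 2))) (var m)) (var m))).eval w n h (m + 2)
        (Function.update (Function.update ρ m acc) (m + 1) k) =
      if G.Adj c k ∧ k ≠ b then minNonzero acc (table n h c k) else acc := by
    intro k acc
    rw [eval_letE (eval_tableE (a := c) (b := k) (by omega) (by omega)
      (by rw [push2_of_lt hu, hc]) (by simp))]
    have hadj := eval_adjE (h := h) hw (m := m + 3) (x := u) (y := m + 1) (a := c) (b := k)
      (ρ := Function.update (Function.update (Function.update ρ m acc) (m + 1) k) (m + 2)
        (table n h c k)) (by omega) (by omega)
      (by rw [push_of_lt (by omega), push2_of_lt hu, hc]) (by simp)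
    have hne := eval_neE (w := w) (h := h) (m := m + 3) (x := m + 1) (y := v) (a := k) (b := b)
      (ρ := Function.update (Function.update (Function.update ρ m acc) (m + 1) k) (m + 2)
        (table n h c k)) (by omega) (by omega) (by simp)
      (by rw [push_of_lt (by omega), push2_of_lt hv, hb])
    have hm : Function.update (Function.update (Function.update ρ m acc) (m + 1) (k : ℕ)) (m + 2)
        (table n h c k) m = acc := by
      rw [push_of_lt (by omega), push2_fst]
    by_cases h1 : G.Adj c k
    · rw [eval_cond_pos (hadj.2 h1)]
      by_cases h2 : k ≠ b
      · rw [eval_cond_pos (hne.2 h2), if_pos ⟨h1, h2⟩]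
        simp only [eval, hm, Function.update_self, show m < m + 2 + 1 by omega,
          show m + 2 < m + 2 + 1 by omega, if_true, minNonzero]
      · rw [eval_cond_neg (mt hne.1 h2), if_neg (fun h => h2 h.2), eval_var_of_lt (by omega), hm]
    · rw [eval_cond_neg (mt hadj.1 h1), if_neg (fun h => h1 h.1), eval_var_of_lt (by omega), hm]
  have key := iter_induction (N := n) (a := (lit 0).eval w n h m ρ)
    (f := fun k acc => (letE (tableE (m + 2) u (m + 1))
      (cond (adjE (m + 3) u (m + 1)) (cond (neE (m + 1) v)
        (cond (var m) (cond (var (m + 2)) (cond (sub (var m) (var (m + 2))) (var (m + 2)) (var m))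
          (var m)) (var (m + 2))) (var m)) (var m))).eval w n h (m + 2)
        (Function.update (Function.update ρ m acc) (m + 1) k))
    (fun k acc => (acc ≠ 0 → ∃ z, G.Adj c z ∧ z ≠ b ∧ table n h c z = acc) ∧
      ∀ z : Fin n, (z : ℕ) < k → G.Adj c z → z ≠ b → table n h c z ≠ 0 →
        acc ≠ 0 ∧ acc ≤ table n h c z) ?_ ?_
  · exact ⟨key.1, fun z => key.2 z z.2⟩
  · exact ⟨fun h => (h rfl).elim, fun z hz => by omega⟩
  · rintro k hk acc ⟨h1, h2⟩
    rw [show k = ((⟨k, hk⟩ : Fin n) : ℕ) from rfl, step ⟨k, hk⟩ acc]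
    have hlt : ∀ z : Fin n, (z : ℕ) < k + 1 → (z : ℕ) < k ∨ z = ⟨k, hk⟩ := by
      intro z hz
      rw [Fin.ext_iff]
      simp only
      omega
    split_ifs with hc
    · unfold minNonzero
      refine ⟨?_, fun z hz hz1 hz2 hz3 => ?_⟩
      · split_ifs with h3 h4 h5
        · exact fun _ => ⟨⟨k, hk⟩, hc.1, hc.2, rfl⟩
        · exact h1
        · exact h1
        · exact fun _ => ⟨⟨k, hk⟩, hc.1, hc.2, rfl⟩
      · rcases hlt z hz with hz | rfl
        · have := h2 z hz hz1 hz2 hz3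
          split_ifs <;> omega
        · split_ifs <;> omega
    · refine ⟨h1, fun z hz hz1 hz2 hz3 => ?_⟩
      rcases hlt z hz with hz | rfl
      · exact h2 z hz hz1 hz2 hz3
      · exact (hc ⟨hz1, hz2⟩).elim

theorem exists_leastEntry (hw : Encodes w G D t) (h : ℕ → ℕ) (b : Fin n) :
    ∃ μ : Fin n → ℕ, ∀ c, LeastEntry G (table n h) b c (μ c) :=
  ⟨fun c => (leastE 2 0 1).eval w n h 2 fun i => if i = 0 then b else c, fun c =>
    leastEntry_leastE hw (by omega) (by omega) (by simp) (by simp)⟩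

theorem eval_leastE (hw : Encodes w G D t) {v u : ℕ} {b c : Fin n} {x : ℕ} (hv : v < m)
    (hu : u < m) (hb : ρ v = b) (hc : ρ u = c) (hx : LeastEntry G (table n h) b c x) :
    (leastE m v u).eval w n h m ρ = x :=
  (leastEntry_leastE hw hv hu hb hc).unique hx

open Classical in
/-- the number of children of `v`, seen from `p`, whose mask has the digit `i` -/
noncomputable def digitCount (G : SimpleGraph (Fin n)) (D : Finset (Fin n)) (p v : Fin n)
    (μ : Fin n → ℕ) (i : ℕ) : ℕ :=
  (Finset.univ.filter fun u => Child G D p v u ∧ (μ u).testBit i = true).card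

/-- the number of children of the vertex `v`, seen from `p`, whose mask has the digit `i` -/
def countE (m p v i : ℕ) : Expr :=
  fold false (lit 0) (cond (childE (m + 2) p v (m + 1))
    (letE (leastE (m + 2) v (m + 1)) (add (var m) (bitE (m + 3) (m + 2) i))) (var m))

theorem eval_countE (hw : Encodes w G D t) {p v i : ℕ} {a b : Fin n} {μ : Fin n → ℕ}
    (hp : p < m) (hv : v < m) (hi : i < m) (ha : ρ p = a) (hb : ρ v = b) (hin : ρ i < n)
    (hμ : ∀ c, LeastEntry G (table n h) b c (μ c)) (hlt : ∀ c, μ c < 2 ^ n) :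
    (countE m p v i).eval w n h m ρ = digitCount G D a b μ (ρ i) := by
  classical
  rw [countE, eval_fold_false, digitCount, Finset.card_filter,
    iter_sum (f := fun u => if Child G D a b u ∧ (μ u).testBit (ρ i) = true then 1 else 0)]
  · simp [eval]
  intro k acc
  have hchild := eval_childE (h := h) hw (m := m + 2) (p := p) (v := v) (u := m + 1) (a := a)
    (b := b) (c := k) (ρ := Function.update (Function.update ρ m acc) (m + 1) k) (by omega)
    (by omega) (by omega) (by rw [push2_of_lt hp, ha]) (by rw [push2_of_lt hv, hb]) (by simp)
  by_cases h1 : Child G D a b k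
  · have hρi : Function.update (Function.update (Function.update ρ m acc) (m + 1) (k : ℕ)) (m + 2)
        (μ k) i = ρ i := by
      rw [push_of_lt (by omega), push2_of_lt hi]
    have hbit := eval_bitE (w := w) (h := h) (m := m + 3) (x := m + 2) (b := i) (n := n)
      (ρ := Function.update (Function.update (Function.update ρ m acc) (m + 1) (k : ℕ)) (m + 2)
        (μ k)) (by omega) (by omega) (by simpa using hlt k) (by rwa [hρi])
    rw [hρi, Function.update_self] at hbit
    rw [eval_cond_pos (hchild.2 h1), eval_letE (eval_leastE hw (by omega) (by omega)
      (by rw [push2_of_lt hv, hb]) (by simp) (hμ k)), eval, hbit, eval_var_of_lt (by omega),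
      push_of_lt (by omega), push2_fst]
    simp [h1]
  · rw [eval_cond_neg (mt hchild.1 h1), eval_var_of_lt (by omega), push2_fst]
    simp [h1]

/-- does the digit `i` belong to `merge`? -/
def digitE (m p v i : ℕ) : Expr :=
  letE (countE m p v i) (cond (var m) (lit 1) (fold false (lit 0)
    (cond (sub (var i) (var (m + 2))) (var (m + 1))
      (letE (countE (m + 3) p v (m + 2)) (cond (sub (var (m + 3)) (lit 1)) (lit 1)
        (var (m + 1)))))))

theorem eval_digitE (hw : Encodes w G D t) {p v i : ℕ} {a b : Fin n} {μ : Fin n → ℕ}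
    (hp : p < m) (hv : v < m) (hi : i < m) (ha : ρ p = a) (hb : ρ v = b) (hin : ρ i < n)
    (hμ : ∀ c, LeastEntry G (table n h) b c (μ c)) (hlt : ∀ c, μ c < 2 ^ n) :
    (digitE m p v i).eval w n h m ρ ≠ 0 ↔ (∃ u, Child G D a b u ∧ (μ u).testBit (ρ i) = true) ∨
      ∃ j, ρ i ≤ j ∧ j < n ∧ ∃ u u', Child G D a b u ∧ Child G D a b u' ∧ u ≠ u' ∧
        (μ u).testBit j = true ∧ (μ u').testBit j = true := by
  classical
  have hpos : ∀ j, digitCount G D a b μ j ≠ 0 ↔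
      ∃ u, Child G D a b u ∧ (μ u).testBit j = true := by
    intro j
    rw [digitCount, ← Nat.pos_iff_ne_zero, Finset.card_pos]
    simp [Finset.Nonempty]
  have htwo : ∀ j, digitCount G D a b μ j - 1 ≠ 0 ↔ ∃ u u', Child G D a b u ∧
      Child G D a b u' ∧ u ≠ u' ∧ (μ u).testBit j = true ∧ (μ u').testBit j = true := by
    intro j
    rw [digitCount, ← Nat.pos_iff_ne_zero, Nat.sub_pos_iff_lt, Finset.one_lt_card]
    simp only [Finset.mem_filter, Finset.mem_univ, true_and]
    constructor
    · rintro ⟨u, ⟨h1, h2⟩, u', ⟨h3, h4⟩, h5⟩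
      exact ⟨u, u', h1, h3, h5, h2, h4⟩
    · rintro ⟨u, u', h1, h3, h5, h2, h4⟩
      exact ⟨u, ⟨h1, h2⟩, u', ⟨h3, h4⟩, h5⟩
  rw [digitE, eval_letE (eval_countE hw hp hv hi ha hb hin hμ hlt)]
  by_cases h1 : digitCount G D a b μ (ρ i) ≠ 0
  · rw [eval_cond_pos (by simpa [eval] using h1)]
    simpa [eval] using Or.inl ((hpos _).1 h1)
  rw [or_iff_right (mt (hpos _).2 h1), eval_cond_neg (by simpa [eval] using h1),
    eval_fold_false, eval,
    iter_exists (P := fun j : Fin n => ρ i ≤ j ∧ digitCount G D a b μ j - 1 ≠ 0)]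
  · have hex : (∃ j : Fin n, ρ i ≤ j ∧ digitCount G D a b μ j - 1 ≠ 0) ↔
        ∃ j, ρ i ≤ j ∧ j < n ∧ ∃ u u', Child G D a b u ∧ Child G D a b u' ∧ u ≠ u' ∧
          (μ u).testBit j = true ∧ (μ u').testBit j = true := by
      refine Fin.exists_iff.trans (exists_congr fun j => ?_)
      rw [← htwo j]
      exact ⟨fun ⟨h1, h2, h3⟩ => ⟨h2, h1, h3⟩, fun ⟨h1, h2, h3⟩ => ⟨h2, h1, h3⟩⟩
    rw [← hex]
    split_ifs with h <;> simp [h]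
  · intro k acc
    have hvar : ∀ x, x < m → ∀ y : ℕ, Function.update (Function.update (Function.update ρ m y)
        (m + 1) acc) (m + 2) (k : ℕ) x = ρ x := by
      intro x hx y
      rw [push_of_lt (by omega), push2_of_lt hx]
    have hacc : ∀ y : ℕ, Function.update (Function.update (Function.update ρ m y)
        (m + 1) acc) (m + 2) (k : ℕ) (m + 1) = acc := by
      intro y
      rw [push_of_lt (by omega), Function.update_self]
    by_cases h2 : ρ i ≤ k
    · rw [eval_cond_neg, eval_letE (eval_countE hw (by omega) (by omega) (by omega)
        (by rw [hvar p hp, ha]) (by rw [hvar v hv, hb]) (by simp) hμ hlt)]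
      · rw [Function.update_self]
        by_cases h3 : digitCount G D a b μ k - 1 ≠ 0
        · rw [eval_cond_pos (by simpa [eval] using h3), if_pos ⟨h2, h3⟩, eval]
        · rw [eval_cond_neg (by simpa [eval] using h3), if_neg (fun h => h3 h.2),
            eval_var_of_lt (by omega), push_of_lt (by omega), hacc]
      · simp only [eval]
        rw [if_pos (by omega), if_pos (by omega), hvar i hi, Function.update_self]
        omega
    · rw [eval_cond_pos, eval_var_of_lt (by omega), hacc, if_neg (fun h => h2 h.1)]
      simp only [eval]
      rw [if_pos (by omega), if_pos (by omega), hvar i hi, Function.update_self]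
      omega

/-- the value of `merge` for the children of `v` seen from `p` -/
def mergeE (m p v : ℕ) : Expr :=
  fold false (lit 0) (cond (digitE (m + 2) p v (m + 1))
    (add (var m) (powE false (m + 2) (m + 1))) (var m))

theorem eval_mergeE (hw : Encodes w G D t) {p v : ℕ} {a b : Fin n} {μ : Fin n → ℕ}
    (hp : p < m) (hv : v < m) (ha : ρ p = a) (hb : ρ v = b)
    (hμ : ∀ c, LeastEntry G (table n h) b c (μ c)) (hlt : ∀ c, μ c < 2 ^ n) :
    (mergeE m p v).eval w n h m ρ = merge n (Child G D a b) μ := by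
  classical
  let P : ℕ → Prop := fun i => (∃ u, Child G D a b u ∧ (μ u).testBit i = true) ∨
    ∃ j, i ≤ j ∧ j < n ∧ ∃ u u', Child G D a b u ∧ Child G D a b u' ∧ u ≠ u' ∧
      (μ u).testBit j = true ∧ (μ u').testBit j = true
  rw [mergeE, eval_fold_false, iter_sum (f := fun i : Fin n => if P i then 2 ^ (i : ℕ) else 0),
    merge, mask, Finset.sum_range, eval, Nat.zero_add]
  · exact Finset.sum_congr rfl fun i _ => by congr
  intro k acc
  have hd := eval_digitE (h := h) hw (m := m + 2) (p := p) (v := v) (i := m + 1) (a := a)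
    (b := b) (ρ := Function.update (Function.update ρ m acc) (m + 1) k) (by omega)
    (by omega) (by omega) (by rw [push2_of_lt hp, ha]) (by rw [push2_of_lt hv, hb])
    (by simp) hμ hlt
  rw [Function.update_self] at hd
  by_cases h1 : P k
  · rw [eval_cond_pos (hd.2 h1), if_pos h1, eval, eval_powE (by omega), Function.update_self,
      eval_var_of_lt (by omega), push2_fst, if_neg Bool.false_ne_true, min_eq_right k.2.le]
  · rw [eval_cond_neg (mt hd.1 h1), if_neg h1, eval_var_of_lt (by omega), push2_fst, Nat.add_zero]

/-- does some child of `v`, seen from `p`, have no entry in the table? -/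
def missingE (m p v : ℕ) : Expr :=
  fold false (lit 0) (cond (childE (m + 2) p v (m + 1))
    (cond (leastE (m + 2) v (m + 1)) (var m) (lit 1)) (var m))

theorem eval_missingE (hw : Encodes w G D t) {p v : ℕ} {a b : Fin n} {μ : Fin n → ℕ}
    (hp : p < m) (hv : v < m) (ha : ρ p = a) (hb : ρ v = b)
    (hμ : ∀ c, LeastEntry G (table n h) b c (μ c)) :
    (missingE m p v).eval w n h m ρ ≠ 0 ↔ ∃ u, Child G D a b u ∧ μ u = 0 := by
  classical
  rw [missingE, eval_fold_false, eval,
    iter_exists (P := fun u => Child G D a b u ∧ μ u = 0)]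
  · split_ifs with h <;> simp [h]
  intro k acc
  have hchild := eval_childE (h := h) hw (m := m + 2) (p := p) (v := v) (u := m + 1) (a := a)
    (b := b) (c := k) (ρ := Function.update (Function.update ρ m acc) (m + 1) k) (by omega)
    (by omega) (by omega) (by rw [push2_of_lt hp, ha]) (by rw [push2_of_lt hv, hb]) (by simp)
  have hleast := eval_leastE (h := h) hw (m := m + 2) (v := v) (u := m + 1)
    (b := b) (c := k) (ρ := Function.update (Function.update ρ m acc) (m + 1) k) (by omega)
    (by omega) (by rw [push2_of_lt hv, hb]) (by simp) (hμ k)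
  by_cases h1 : Child G D a b k
  · rw [eval_cond_pos (hchild.2 h1)]
    by_cases h2 : μ k = 0
    · rw [eval_cond_neg (by rw [hleast, h2]; simp), if_pos ⟨h1, h2⟩, eval]
    · rw [eval_cond_pos (by rwa [hleast]), if_neg (fun h => h2 h.2), eval_var_of_lt (by omega),
        push2_fst]
  · rw [eval_cond_neg (mt hchild.1 h1), if_neg (fun h => h1 h.1), eval_var_of_lt (by omega),
      push2_fst]

/-- the new entry of the table for the pair `p`, `v` -/
def newEntryE (m p v : ℕ) : Expr :=
  cond (guardE m v) (lit 0) (cond (missingE m p v) (lit 0)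
    (letE (add (mergeE m p v) (lit 1))
      (cond (sub (powSizeE (m + 1)) (var m)) (var m) (lit 0))))

theorem eval_newEntryE (hw : Encodes w G D t) {p v : ℕ} {a b : Fin n} {μ : Fin n → ℕ}
    (hp : p < m) (hv : v < m) (ha : ρ p = a) (hb : ρ v = b)
    (hμ : ∀ c, LeastEntry G (table n h) b c (μ c)) (hlt : ∀ c, μ c < 2 ^ n) :
    (newEntryE m p v).eval w n h m ρ = newEntry G D a b μ := by
  rw [newEntryE, newEntry, Fintype.card_fin]
  by_cases h1 : b ∈ D
  · rw [eval_cond_pos ((eval_guardE hw hv hb).2 h1), if_pos h1, eval]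
  rw [eval_cond_neg (mt (eval_guardE hw hv hb).1 h1), if_neg h1]
  by_cases h2 : ∃ u, Child G D a b u ∧ μ u = 0
  · rw [eval_cond_pos ((eval_missingE hw hp hv ha hb hμ).2 h2), if_pos h2, eval]
  rw [eval_cond_neg (mt (eval_missingE hw hp hv ha hb hμ).1 h2), if_neg h2,
    eval_letE (v := merge n (Child G D a b) μ + 1)
      (by rw [eval, eval_mergeE hw hp hv ha hb hμ hlt, eval])]
  by_cases h3 : merge n (Child G D a b) μ + 1 < 2 ^ n
  · rw [eval_cond_pos, if_pos h3, eval_var_of_lt (by omega), Function.update_self]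
    rw [eval, eval_powSizeE, eval_var_of_lt (by omega), Function.update_self]
    omega
  · rw [eval_cond_neg, if_neg h3, eval]
    rw [eval, eval_powSizeE, eval_var_of_lt (by omega), Function.update_self]
    omega

end Expr

/-! ### Filling in the table -/

section Rounds

variable {w : List Bool} {n : ℕ} {G : SimpleGraph (Fin n)} {D : Finset (Fin n)} {t : ℕ}

/-- Recompute all entries of the table, one after the other, as many times as there are
vertices. -/
def roundsC : Cmd :=
  .iterate (.iterate (.iterate (.store (add (mulE 3 1) (var 2)) (newEntryE 3 1 2))))

/-- The state of the table after `k` rounds and, in the next round, after all entries for pairs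
that precede `(i, j)` in the lexicographic order. -/
structure Progress (G : SimpleGraph (Fin n)) (D : Finset (Fin n)) (k i j : ℕ) (h : ℕ → ℕ) :
    Prop where
  sound : Sound G D (table n h)
  complete : ∀ p v, Complete G D (table n h) k p v
  complete_succ : ∀ p v : Fin n, ((p : ℕ) < i ∨ (p : ℕ) = i ∧ (v : ℕ) < j) →
    Complete G D (table n h) (k + 1) p v

theorem table_update {h : ℕ → ℕ} {x : ℕ} (a b p v : Fin n) :
    table n (Function.update h (n * a + b) x) p v =
      if p = a ∧ v = b then x else table n h p v := by
  unfold table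
  split_ifs with hc
  · rw [hc.1, hc.2, Function.update_self]
  · rw [Function.update_of_ne]
    intro heq
    have h1 := congrArg (· % n) heq
    have h2 := congrArg (· / n) heq
    have hn : 0 < n := a.pos
    simp only [Nat.mul_add_mod, Nat.mod_eq_of_lt v.2, Nat.mod_eq_of_lt b.2, Nat.mul_add_div hn,
      Nat.div_eq_of_lt v.2, Nat.div_eq_of_lt b.2, Nat.add_zero] at h1 h2
    exact hc ⟨Fin.ext h2, Fin.ext h1⟩

theorem Progress.step (hG : G.IsTree) (hw : Encodes w G D t) {k : ℕ} {a b : Fin n} {h : ℕ → ℕ}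
    {ρ : ℕ → ℕ} (hρ1 : ρ 1 = a) (hρ2 : ρ 2 = b) (hP : Progress G D k a b h) :
    Progress G D k a (b + 1)
      ((Cmd.store (add (mulE 3 1) (var 2)) (newEntryE 3 1 2)).run w n 3 ρ h) := by
  obtain ⟨μ, hμ⟩ := exists_leastEntry hw h b
  have hlt : ∀ c, μ c < 2 ^ n := by
    intro c
    by_cases h0 : μ c = 0
    · rw [h0]
      positivity
    · obtain ⟨z, -, -, hz⟩ := (hμ c).attained h0
      have := (hP.sound c z (by rwa [hz])).1
      rwa [hz, Fintype.card_fin] at this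
  rw [Cmd.run, eval, eval_mulE (by omega), eval_var_of_lt (by omega), hρ1, hρ2,
    eval_newEntryE hw (by omega) (by omega) hρ1 hρ2 hμ hlt]
  have hcomp : ∀ k', (∀ p v, Complete G D (table n h) k' p v) → Complete G D
      (table n (Function.update h (n * a + b) (newEntry G D a b μ))) (k' + 1) a b := by
    intro k' hk' hab hcard x hx hbr
    rw [table_update, if_pos ⟨rfl, rfl⟩]
    exact newEntry_complete hG (fun u _ => hμ u) hk' hab hcard hx hbr
  have hother : ∀ k' p v, ¬ (p = a ∧ v = b) → Complete G D (table n h) k' p v → Complete G D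
      (table n (Function.update h (n * a + b) (newEntry G D a b μ))) k' p v := by
    intro k' p v hne hc
    unfold Complete
    rwa [table_update, if_neg hne]
  refine ⟨fun p v => ?_, fun p v => ?_, fun p v hpv => ?_⟩
  · rw [table_update]
    split_ifs with hc
    · rw [hc.1, hc.2]
      exact newEntry_sound hP.sound fun u _ => hμ u
    · exact hP.sound p v
  · by_cases hc : p = a ∧ v = b
    · rw [hc.1, hc.2]
      exact fun h1 h2 => hcomp k hP.complete h1 (by omega)
    · exact hother k p v hc (hP.complete p v)
  · by_cases hc : p = a ∧ v = b
    · rw [hc.1, hc.2]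
      exact hcomp k hP.complete
    · refine hother _ p v hc (hP.complete_succ p v ?_)
      rw [Fin.ext_iff, Fin.ext_iff] at hc
      omega

theorem progress_rounds (hG : G.IsTree) (hw : Encodes w G D t) :
    Progress G D n 0 0 (roundsC.run w n 0 (fun _ => 0) fun _ => 0) := by
  rw [roundsC, Cmd.run]
  refine iter_induction (fun k h => Progress G D k 0 0 h) ⟨?_, ?_, ?_⟩ fun k hk h hP => ?_
  · exact fun p v h0 => (h0 rfl).elim
  · intro p v hpv hcard
    have : 0 < branchCard G p v := Finset.card_pos.2 ⟨v, by simpa using inBranch_self hpv⟩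
    omega
  · exact fun p v h => by omega
  rw [Cmd.run]
  have hround := iter_induction (N := n) (a := h)
    (f := fun i h => Cmd.run w n (.iterate (.store (add (mulE 3 1) (var 2)) (newEntryE 3 1 2)))
      (0 + 1 + 1) (Function.update (Function.update (fun _ => 0) 0 k) (0 + 1) i) h)
    (fun i h => Progress G D k i 0 h) hP fun i hi h hP => by
      rw [Cmd.run]
      have hrow := iter_induction (N := n) (a := h)
        (f := fun j h => Cmd.run w n (.store (add (mulE 3 1) (var 2)) (newEntryE 3 1 2))
          (0 + 1 + 1 + 1) (Function.update (Function.update (Function.update (fun _ => 0) 0 k)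
            (0 + 1) i) (0 + 1 + 1) j) h)
        (fun j h => Progress G D k i j h) hP fun j hj h hP =>
          Progress.step (a := ⟨i, hi⟩) (b := ⟨j, hj⟩) hG hw (by simp) (by simp) hP
      exact ⟨hrow.sound, hrow.complete, fun p v hpv => hrow.complete_succ p v (by omega)⟩
  exact ⟨hround.sound, fun p v => hround.complete_succ p v (Or.inl p.2),
    fun p v hpv => by omega⟩

/-- the number `t` -/
def timeE (m : ℕ) : Expr :=
  letE (sqE m) (fold true (lit 0) (cond
    (sub (read (add (add (add (add size (lit 1)) (var m)) size) (var (m + 2)))) (lit 1))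
    (add (var (m + 1)) (powE true (m + 3) (m + 2))) (var (m + 1))))

theorem mask_testBit {N x : ℕ} (hx : x < 2 ^ N) : mask N (fun b => x.testBit b = true) = x := by
  refine Nat.eq_of_testBit_eq fun i => ?_
  rw [Bool.eq_iff_iff, testBit_mask, and_iff_right_iff_imp]
  exact lt_two_pow_iff_testBit.1 hx i

theorem eval_timeE (hw : Encodes w G D t) {h ρ : ℕ → ℕ} {m : ℕ} :
    (timeE m).eval w n h m ρ = t := by
  classical
  rw [timeE, eval_letE eval_sqE, eval, if_pos rfl,
    iter_sum (f := fun k : Fin w.length => if t.testBit k = true then 2 ^ (k : ℕ) else 0),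
    eval, Nat.zero_add]
  · conv_rhs => rw [← mask_testBit hw.time_lt, mask, Finset.sum_range]
    exact Finset.sum_congr rfl fun i _ => by congr
  intro k acc
  have hcond : (sub (read (add (add (add (add size (lit 1)) (var m)) size) (var (m + 2))))
      (lit 1)).eval w n h (m + 3) (Function.update (Function.update (Function.update ρ m (n * n))
        (m + 1) acc) (m + 2) k) ≠ 0 ↔ t.testBit k = true := by
    rw [← hw.time k]
    simp [eval]
  by_cases h1 : t.testBit k = true
  · rw [eval_cond_pos (hcond.2 h1), if_pos h1, eval, eval_var_of_lt (by omega), push2_fst,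
      eval_powE (by omega), Function.update_self, if_pos rfl, min_eq_right k.2.le]
  · rw [eval_cond_neg (mt hcond.1 h1), if_neg h1, eval_var_of_lt (by omega), push2_fst,
      Nat.add_zero]

/-- is there a vertex `v` such that the entry for the pair `v`, `v` is less than `2 ^ t`? -/
def answerE : Expr :=
  letE (timeE 0) (letE (powE false 1 0) (fold false (lit 0) (letE (tableE 4 3 3)
    (cond (var 4) (cond (sub (var 1) (var 4)) (lit 1) (var 2)) (var 2)))))

open Classical in
theorem eval_answerE (hw : Encodes w G D t) {h : ℕ → ℕ} :
    answerE.eval w n h 0 (fun _ => 0) =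
      if ∃ v, table n h v v ≠ 0 ∧ table n h v v < 2 ^ min n t then 1 else 0 := by
  rw [answerE, eval_letE (eval_timeE hw), eval_letE (eval_powE (by omega)), eval_fold_false, eval,
    iter_exists (P := fun v => table n h v v ≠ 0 ∧ table n h v v < 2 ^ min n t) ?_]
  · congr
  intro k acc
  rw [eval_letE (eval_tableE (a := k) (b := k) (by omega) (by omega) (by simp) (by simp))]
  simp only [eval, Function.update_apply]
  by_cases h1 : table n h k k = 0
  · simp [h1]
  · by_cases h2 : table n h k k < 2 ^ min n t
    · simp [h1, h2, Nat.sub_eq_zero_iff_le]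
    · simp [h1, h2, not_lt.1 h2]

/-- the number of vertices, read off its unary representation -/
def sizeE : Expr :=
  fold true (lit 0) (cond (sub (read (var 0)) (lit 1)) (add (var 0) (lit 1)) (var 0))

theorem eval_sizeE (h1 : ∀ i < n, symbol w i = 2) (h2 : symbol w n = 1) (hn : n ≤ w.length)
    {N : ℕ} {h ρ : ℕ → ℕ} : sizeE.eval w N h 0 ρ = n := by
  rw [sizeE, eval, if_pos rfl]
  have := iter_induction (N := w.length) (a := (lit 0).eval w N h 0 ρ)
    (f := fun k acc => (cond (sub (read (var 0)) (lit 1)) (add (var 0) (lit 1)) (var 0)).eval w N h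
      (0 + 2) (Function.update (Function.update ρ 0 acc) (0 + 1) k))
    (fun k acc => acc = min k n) (by simp [eval]) fun k _ acc hacc => by
      simp only [eval, push2_fst, show 0 < 0 + 2 by omega, if_true]
      rcases Nat.lt_or_ge k n with hk | hk
      · rw [min_eq_left hk.le] at hacc
        rw [hacc, h1 k hk, min_eq_left (by omega), if_pos (by omega)]
      · rw [min_eq_right hk] at hacc
        rw [hacc, h2, min_eq_right (by omega), if_neg (by omega)]
  rw [this, min_eq_right hn]

end Rounds

/-! ### The encoding of instances -/

section Encoding

theorem symbol_append_left {l l' : List Bool} {p : ℕ} (hp : p < l.length) :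
    symbol (l ++ l') p = symbol l p := by
  rw [symbol, symbol, List.getElem?_append_left hp]

theorem symbol_append_right (l l' : List Bool) (p : ℕ) :
    symbol (l ++ l') (l.length + p) = symbol l' p := by
  rw [symbol, symbol, List.getElem?_append_right (by omega), Nat.add_sub_cancel_left]

theorem symbol_sub_one_ne_zero {l : List Bool} {p : ℕ} :
    symbol l p - 1 ≠ 0 ↔ l[p]? = some true := by
  rw [symbol]
  rcases l[p]? with _ | _ | _ <;> simp

theorem Instance.encode_eq (I : Instance) : ∃ A B : List Bool,
    I.encode = (List.replicate I.n true ++ [false]) ++ (A ++ (B ++ I.t.bits)) ∧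
    A.length = I.n * I.n ∧ B.length = I.n ∧
    (∀ a b : Fin I.n, A[I.n * a + b]? = some true ↔ I.G.Adj a b) ∧
    (∀ a : Fin I.n, B[(a : ℕ)]? = some true ↔ a ∈ I.D) := by
  classical
  refine ⟨List.ofFn fun k : Fin (I.n * I.n) => decide (I.G.Adj k.divNat k.modNat),
    List.ofFn fun i : Fin I.n => decide (i ∈ I.D), ?_, ?_, ?_, ?_, ?_⟩
  · rw [Instance.encode, List.append_assoc, List.append_assoc]
  · rw [List.length_ofFn]
  · rw [List.length_ofFn]
  · intro a b
    have hlt : I.n * a + b < I.n * I.n := by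
      have h1 : I.n * (a + 1) ≤ I.n * I.n := Nat.mul_le_mul_left _ a.2
      have h2 := b.2
      rw [Nat.mul_add] at h1
      omega
    have h1 : (⟨I.n * a + b, hlt⟩ : Fin (I.n * I.n)).divNat = a := by
      refine Fin.ext ?_
      rw [Fin.coe_divNat, Nat.mul_add_div a.pos, Nat.div_eq_of_lt b.2, Nat.add_zero]
    have h2 : (⟨I.n * a + b, hlt⟩ : Fin (I.n * I.n)).modNat = b := by
      refine Fin.ext ?_
      rw [Fin.coe_modNat, Nat.mul_add_mod, Nat.mod_eq_of_lt b.2]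
    rw [List.getElem?_ofFn, dif_pos hlt, h1, h2]
    simp
  · intro a
    rw [List.getElem?_ofFn, dif_pos a.2]
    simp

theorem Instance.encodes (I : Instance) : Encodes I.encode I.G I.D I.t ∧ I.n ≤ I.encode.length ∧
    (∀ i < I.n, symbol I.encode i = 2) ∧ symbol I.encode I.n = 1 := by
  obtain ⟨A, B, h, hA, hB, hadj, hguard⟩ := I.encode_eq
  have hpre : (List.replicate I.n true ++ [false]).length = I.n + 1 := by simp
  have hsymA : ∀ k < I.n * I.n, symbol I.encode (I.n + 1 + k) = symbol A k := by
    intro k hk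
    rw [h, ← hpre, symbol_append_right, symbol_append_left (by omega)]
  have hsymB : ∀ k < I.n, symbol I.encode (I.n + 1 + I.n * I.n + k) = symbol B k := by
    intro k hk
    rw [h, ← hpre, ← hA, Nat.add_assoc, symbol_append_right, symbol_append_right,
      symbol_append_left (by omega)]
  have hsymt : ∀ k, symbol I.encode (I.n + 1 + I.n * I.n + I.n + k) = symbol I.t.bits k := by
    intro k
    rw [h, ← hpre, ← hA]
    nth_rewrite 3 [← hB]
    rw [Nat.add_assoc, Nat.add_assoc, symbol_append_right, symbol_append_right,
      symbol_append_right]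
  have hlen : I.encode.length = I.n + 1 + (I.n * I.n + (I.n + I.t.bits.length)) := by
    rw [h, List.length_append, hpre, List.length_append, List.length_append, hA, hB]
  refine ⟨⟨fun a b => ?_, fun a => ?_, fun k => ?_, ?_⟩, by omega, fun i hi => ?_, ?_⟩
  · have hlt : I.n * a + b < I.n * I.n := by
      have h1 : I.n * (a + 1) ≤ I.n * I.n := Nat.mul_le_mul_left _ a.2
      have h2 := b.2
      rw [Nat.mul_add] at h1
      omega
    rw [Nat.add_assoc (I.n + 1), hsymA _ hlt, symbol_sub_one_ne_zero, hadj]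
  · rw [hsymB _ a.2, symbol_sub_one_ne_zero, hguard]
  · rw [hsymt, symbol_sub_one_ne_zero, Nat.testBit_eq_inth, List.getI_eq_getElem?_getD]
    rcases I.t.bits[k]? with _ | _ | _ <;> simp
  · refine (Nat.lt_size_self I.t).trans_le (Nat.pow_le_pow_right (by norm_num) ?_)
    rw [← Nat.size_eq_bits_len]
    omega
  · rw [h, symbol_append_left (by rw [hpre]; omega), symbol_append_left (by simpa using hi), symbol,
      List.getElem?_replicate, if_pos hi]
  · have := symbol_append_right (List.replicate I.n true) ([false] ++ (A ++ (B ++ I.t.bits))) 0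
    rw [List.length_replicate, Nat.add_zero] at this
    rw [h, List.append_assoc, this, symbol_append_left (by simp)]
    rfl

end Encoding

end EternalDomination

/-! ### Fast-Strategy on trees -/

theorem mainTheorem3 :
    RAM.PolyTimeDecidable
      (fun I : {I : EternalDomination.Instance // I.G.IsTree} => I.1.encode)
      (fun I => I.1.FastStrategy) := by
  classical
  obtain ⟨prog, p, hprog⟩ :=
    RAM.exists_prog EternalDomination.sizeE EternalDomination.roundsC EternalDomination.answerE
  refine ⟨prog, p, fun ⟨I, hG⟩ => ?_⟩
  obtain ⟨hw, hlen, h2, h1⟩ := I.encodes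
  obtain ⟨k, M, hexec, hk, hM⟩ := hprog I.encode I.n (EternalDomination.eval_sizeE h2 h1 hlen) hlen
  refine ⟨k, M, hexec, hk, hM.trans ?_⟩
  have hP := EternalDomination.progress_rounds hG hw
  rw [EternalDomination.eval_answerE hw]
  refine if_congr ?_ rfl rfl
  change _ ↔ EternalDomination.attackTime I.G I.D ≤ I.t
  rw [EternalDomination.attackTime_le_iff, EternalDomination.wins_iff_table hG hP.sound
    (by simpa using hP.complete), Fintype.card_fin]
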